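/- Let $M$ be a closed smooth Riemannian manifold with Riemannian distance $d$, let $X$ be a $C^1$ vector field on $M$, and let $X_t$ be its flow. A singularity of $X$ is a zero of $X$; the other points are called regular. A singularity $\sigma$ is hyperbolic if $T_\sigma M=E^s\oplus E^u$ with $E^s,E^u$ invariant under $DX(\sigma)$ and there are $C,\lambda>0$ such that the linear flow $DX_t=e^{tDX(\sigma)}$ satisfies $\|DX_t|_{E^s}\|\le Ce^{-\lambda t}$ and $\|DX_{-t}|_{E^u}\|\le Ce^{-\lambda t}$ for all $t\ge 0$. A set $\Lambda\subset M$ is invariant if $X_t(\Lambda)=\Lambda$ for all $t\in\mathbb R$, and a singularity is attached to $\Lambda$ if it lies in the closure of the set of regular points of $\Lambda$. For $\delta>0$, a $\delta$-$1$-pseudo-orbit is a sequence $(x_i,t_i)_{a\le i\le b}$, with $-\infty\le a<b\le\infty$, of points $x_i\in M$ and times $t_i\ge 1$ such that $d(X_{t_i}(x_i),x_{i+1})\le\delta$ whenever $i$ and $i+1$ are indices. A closed invariant set $\Lambda$ is chain-recurrent if for every $x\in\Lambda$ and every $\varepsilon>0$ there is a finite $\varepsilon$-$1$-pseudo-orbit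 $(x_i,t_i)_{0\le i\le N}$, $N\geq 1$, of points $x_i\in\Lambda$ with $x_0=x_N=x$. The vector field $X$ has the shadowing property on $\Lambda$ if for every $\varepsilon>0$ there is $\delta>0$ such that for every $\delta$-$1$-pseudo-orbit $(x_i,t_i)_{a\le i\le b}$ of points of $\Lambda$, indexed with $a\le 0\le b$, there are $y\in\Lambda$ and an increasing homeomorphism $h:\mathbb R\to\mathbb R$ with $h(0)=0$ such that $$d\bigl(X_{h(t)}(y),X_{t-s_i}(x_i)\bigr)\le\varepsilon\qquad\text{for all } a\le i\le b \text{ and } t\in[s_i,s_{i+1}),$$ where $s_0=0$ and $s_{i+1}=s_i+t_i$. For a singularity $\sigma$ let $HL(\sigma)$ be the set of regular points $p$ with $X_t(p)\to\sigma$ both as $t\to+\infty$ and as $t\to-\infty$ (the points of homoclinic loops attached to $\sigma$), and let $O(p)=\{X_t(p):t\in\mathbb R\}$. A neighbourhood $V$ of $\sigma$ in $M$ is adapted if $\partial V\cap O(p)$ is finite for every $p\in HL(\sigma)$; write $n(p,V,\sigma)=\#(\partial V\cap O(p))$. **Theorem.** Let $\Lambda$ be a chain-recurrent set of $X$ and let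 $\sigma\in\Lambda$ be a hyperbolic singularity attached to $\Lambda$. If for every adapted neighbourhood $V$ of $\sigma$ there is an integer $N>0$ such that $n(p,V,\sigma)\le N$ for every $p\in HL(\sigma)$, then $X$ does not have the shadowing property on $\Lambda$. -/

import Mathlib

open Set Filter Topology Manifold Bundle
open scoped ContDiff

namespace ShadowFlow

noncomputable section

/-! ### The flow, singularities, orbits -/

section Flow

variable {n : ℕ} {M : Type*} [TopologicalSpace M] [ChartedSpace (EuclideanSpace ℝ (Fin n)) M]
  [IsManifold (𝓡 n) ∞ M]

/-- The vector field `X` is of class `C^1`, as a section of the tangent bundle. -/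
def IsC1VectorField (X : (x : M) → TangentSpace (𝓡 n) x) : Prop :=
  ContMDiff (𝓡 n) (𝓡 n).tangent 1 (fun x => (⟨x, X x⟩ : TangentBundle (𝓡 n) M))

open Classical in
/-- The flow `X_t(x)` of `X`: the value at time `t` of the integral curve of `X`, defined on all
of `ℝ`, which starts at `x`. For a `C^1` vector field on a closed manifold this curve exists and is
unique for every `x`; the value `x` when there is no such curve is a convention. -/
def flow (X : (x : M) → TangentSpace (𝓡 n) x) (t : ℝ) (x : M) : M :=
  if h : ∃ γ : ℝ → M, γ 0 = x ∧ IsMIntegralCurve γ X then h.choose t else x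

/-- A singularity of `X`. The other points are the regular points. -/
def IsSingularity (X : (x : M) → TangentSpace (𝓡 n) x) (p : M) : Prop := X p = 0

/-- The orbit `O(x)`. -/
def orbit (X : (x : M) → TangentSpace (𝓡 n) x) (x : M) : Set M :=
  Set.range (fun t : ℝ => flow X t x)

/-- `X_t(Λ) = Λ` for every `t`. -/
def IsInvariantSet (X : (x : M) → TangentSpace (𝓡 n) x) (Λ : Set M) : Prop :=
  ∀ t : ℝ, flow X t '' Λ = Λ

/-- `σ` is a singularity accumulated by regular points of `Λ`. -/
def IsAttached (X : (x : M) → TangentSpace (𝓡 n) x) (Λ : Set M) (σ : M) : Prop :=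
  IsSingularity X σ ∧ σ ∈ closure {x ∈ Λ | ¬ IsSingularity X x}

/-- The stable set `W^s(σ)`. -/
def stableSet (X : (x : M) → TangentSpace (𝓡 n) x) (σ : M) : Set M :=
  {x | Tendsto (fun t : ℝ => flow X t x) atTop (𝓝 σ)}

/-- The unstable set `W^u(σ)`. -/
def unstableSet (X : (x : M) → TangentSpace (𝓡 n) x) (σ : M) : Set M :=
  {x | Tendsto (fun t : ℝ => flow X t x) atBot (𝓝 σ)}

/-- The points of the homoclinic loops attached to `σ`: regular points of
`W^s(σ) ∩ W^u(σ)`. -/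
def HL (X : (x : M) → TangentSpace (𝓡 n) x) (σ : M) : Set M :=
  {p | ¬ IsSingularity X p ∧ p ∈ stableSet X σ ∧ p ∈ unstableSet X σ}

/-- `V` is an adapted neighbourhood of `σ`: every homoclinic loop attached to `σ` meets `∂V` in
finitely many points. -/
def IsAdaptedNhd (X : (x : M) → TangentSpace (𝓡 n) x) (σ : M) (V : Set M) : Prop :=
  V ∈ 𝓝 σ ∧ ∀ p ∈ HL X σ, (frontier V ∩ orbit X p).Finite

/-- `n(p, V, σ)`: the number of points of `∂V ∩ O(p)`, as an element of `ℕ ∪ {∞}`. -/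
def crossings (X : (x : M) → TangentSpace (𝓡 n) x) (V : Set M) (p : M) : ℕ∞ :=
  (frontier V ∩ orbit X p).encard

/-! ### Hyperbolic singularities -/

/-- The vector field `X` read in the preferred chart at `σ`. -/
def chartField (X : (x : M) → TangentSpace (𝓡 n) x) (σ : M) :
    EuclideanSpace ℝ (Fin n) → EuclideanSpace ℝ (Fin n) := fun u =>
  tangentCoordChange (𝓡 n) ((extChartAt (𝓡 n) σ).symm u) σ ((extChartAt (𝓡 n) σ).symm u)
    (X ((extChartAt (𝓡 n) σ).symm u))

/-- The derivative `DX(σ)` of `X` at a singularity `σ`, an endomorphism of `T_σ M`. (The tangent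
space at `σ` is the model space, read in the preferred chart at `σ`. At a singularity the derivative
does not depend on the chart.) -/
def linearPart (X : (x : M) → TangentSpace (𝓡 n) x) (σ : M) :
    EuclideanSpace ℝ (Fin n) →L[ℝ] EuclideanSpace ℝ (Fin n) :=
  fderiv ℝ (chartField X σ) (extChartAt (𝓡 n) σ σ)

/-- `DX_t`, the linear flow on `T_σ M` generated by `DX(σ)`, that is `exp (t DX(σ))`. -/
def linearFlow (X : (x : M) → TangentSpace (𝓡 n) x) (σ : M) (t : ℝ) :
    EuclideanSpace ℝ (Fin n) →L[ℝ] EuclideanSpace ℝ (Fin n) :=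
  NormedSpace.exp (t • linearPart X σ)

/-- `σ` is a hyperbolic singularity: `T_σ M = E^s ⊕ E^u` with both summands `DX`-invariant,
`‖DX_t v‖ ≤ C e^{-λ t} ‖v‖` on `E^s` and `‖DX_{-t} v‖ ≤ C e^{-λ t} ‖v‖` on `E^u` for all `t ≥ 0`.
The norm is the Riemannian one. -/
def IsHyperbolicSingularity [RiemannianBundle (fun x : M => TangentSpace (𝓡 n) x)]
    (X : (x : M) → TangentSpace (𝓡 n) x) (σ : M) : Prop :=
  IsSingularity X σ ∧
  ∃ Es Eu : Submodule ℝ (TangentSpace (𝓡 n) σ), IsCompl Es Eu ∧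
    (∀ v ∈ Es, (linearPart X σ v : TangentSpace (𝓡 n) σ) ∈ Es) ∧
    (∀ v ∈ Eu, (linearPart X σ v : TangentSpace (𝓡 n) σ) ∈ Eu) ∧
    ∃ C > (0 : ℝ), ∃ lam > (0 : ℝ), ∀ t : ℝ, 0 ≤ t →
      (∀ v ∈ Es, ‖(linearFlow X σ t v : TangentSpace (𝓡 n) σ)‖ ≤ C * Real.exp (-lam * t) * ‖v‖) ∧
      (∀ v ∈ Eu, ‖(linearFlow X σ (-t) v : TangentSpace (𝓡 n) σ)‖
        ≤ C * Real.exp (-lam * t) * ‖v‖)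

end Flow

/-! ### Pseudo-orbits, shadowing, chain recurrence -/

/-- The integers together with `-∞` and `+∞`, where the end points of index intervals live. -/
abbrev ExtInt : Type := WithBot (WithTop ℤ)

/-- An integer as an extended integer. -/
def toExtInt (i : ℤ) : ExtInt := ((i : WithTop ℤ) : WithBot (WithTop ℤ))

/-- The times `s_i` at which the pieces of a pseudo-orbit start: `s_0 = 0`,
`s_i = t_0 + ⋯ + t_{i-1}` for `i > 0` and `s_i = -(t_i + ⋯ + t_{-1})` for `i < 0`. -/
def startTime (t : ℤ → ℝ) : ℤ → ℝ
  | Int.ofNat k => ∑ j ∈ Finset.range k, t (j : ℤ)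
  | Int.negSucc k => -∑ j ∈ Finset.range (k + 1), t (-(j : ℤ) - 1)

theorem startTime_zero (t : ℤ → ℝ) : startTime t 0 = 0 := by
  change ∑ j ∈ Finset.range 0, t (j : ℤ) = 0
  simp

theorem startTime_succ (t : ℤ → ℝ) (i : ℤ) : startTime t (i + 1) = startTime t i + t i := by
  rcases i with k | k
  · change ∑ j ∈ Finset.range (k + 1), t (j : ℤ) = ∑ j ∈ Finset.range k, t (j : ℤ) + t (k : ℤ)
    rw [Finset.sum_range_succ]
  · rcases k with _ | k
    · change ∑ j ∈ Finset.range 0, t (j : ℤ)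
        = -∑ j ∈ Finset.range 1, t (-(j : ℤ) - 1) + t (-1)
      simp
    · have h : Int.negSucc (k + 1) + 1 = Int.negSucc k := by omega
      rw [h]
      change -∑ j ∈ Finset.range (k + 1), t (-(j : ℤ) - 1)
        = -∑ j ∈ Finset.range (k + 1 + 1), t (-(j : ℤ) - 1) + t (Int.negSucc (k + 1))
      rw [Finset.sum_range_succ _ (k + 1)]
      have h' : (-((k + 1 : ℕ) : ℤ) - 1) = Int.negSucc (k + 1) := by omega
      rw [h']
      ring

section Shadowing

variable {n : ℕ} {M : Type*} [EMetricSpace M] [ChartedSpace (EuclideanSpace ℝ (Fin n)) M]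
  [IsManifold (𝓡 n) ∞ M]

/-- `(x_i, t_i)_{a ≤ i ≤ b}`, `-∞ ≤ a < b ≤ ∞`, is a `δ`-`T`-pseudo-orbit: `t_i ≥ T`, and
`d(X_{t_i}(x_i), x_{i+1}) ≤ δ` whenever `i` and `i + 1` are indices. The values of `x` and `t`
outside the index interval play no role. -/
def IsPseudoOrbit (X : (x : M) → TangentSpace (𝓡 n) x) (δ T : ℝ) (a b : ExtInt)
    (x : ℤ → M) (t : ℤ → ℝ) : Prop :=
  a < b ∧
  (∀ i : ℤ, a ≤ toExtInt i → toExtInt i ≤ b → T ≤ t i) ∧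
  (∀ i : ℤ, a ≤ toExtInt i → toExtInt (i + 1) ≤ b →
    edist (flow X (t i) (x i)) (x (i + 1)) ≤ ENNReal.ofReal δ)

/-- The pseudo-orbit is `ε`-shadowed by `y`: for some increasing homeomorphism `h` of `ℝ` with
`h 0 = 0` one has `d(X_{h(τ)}(y), X_{τ - s_i}(x_i)) ≤ ε` for every index `i` and
`τ ∈ [s_i, s_{i+1})`. (The increasing homeomorphisms of `ℝ` are its order automorphisms.) -/
def IsShadowedBy (X : (x : M) → TangentSpace (𝓡 n) x) (ε : ℝ) (a b : ExtInt)
    (x : ℤ → M) (t : ℤ → ℝ) (y : M) : Prop :=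
  ∃ h : ℝ ≃o ℝ, h 0 = 0 ∧
    ∀ i : ℤ, a ≤ toExtInt i → toExtInt i ≤ b →
      ∀ τ ∈ Set.Ico (startTime t i) (startTime t (i + 1)),
        edist (flow X (h τ) y) (flow X (τ - startTime t i) (x i)) ≤ ENNReal.ofReal ε

/-- The shadowing property of `X` on `Λ`: for every `ε > 0` there is `δ > 0` such that every
`δ`-`1`-pseudo-orbit of points of `Λ`, finite or infinite, is `ε`-shadowed by a point of `Λ`. As
the normalisation `s_0 = 0` requires, pseudo-orbits are indexed so that `0` is an index. -/
def HasShadowingProperty (X : (x : M) → TangentSpace (𝓡 n) x) (Λ : Set M) : Prop :=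
  ∀ ε > (0 : ℝ), ∃ δ > (0 : ℝ), ∀ (a b : ExtInt) (x : ℤ → M) (t : ℤ → ℝ),
    a ≤ toExtInt 0 → toExtInt 0 ≤ b → IsPseudoOrbit X δ 1 a b x t →
    (∀ i : ℤ, a ≤ toExtInt i → toExtInt i ≤ b → x i ∈ Λ) →
    ∃ y ∈ Λ, IsShadowedBy X ε a b x t y

/-- `Λ` is a chain-recurrent set: closed, invariant, and for every `ε > 0` every point of `Λ` is
joined to itself by a finite `ε`-`1`-pseudo-orbit of points of `Λ`. -/
structure IsChainRecurrentSet (X : (x : M) → TangentSpace (𝓡 n) x) (Λ : Set M) : Prop where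
  isClosed : IsClosed Λ
  invariant : IsInvariantSet X Λ
  chain : ∀ p ∈ Λ, ∀ ε > (0 : ℝ), ∃ (N : ℕ) (x : ℤ → M) (t : ℤ → ℝ),
    IsPseudoOrbit X ε 1 (toExtInt 0) (toExtInt N) x t ∧
    (∀ i : ℤ, 0 ≤ i → i ≤ N → x i ∈ Λ) ∧ x 0 = p ∧ x N = p

end Shadowing

end

end ShadowFlow

/-! Hyperbolicity gives a small compact box around `σ` that is isolating: an orbit that stays in it
for all large positive (negative) times tends to `σ` in that direction, and only `σ` stays in it for
all times. Suppose shadowing holds, and let `N` bound the boundary crossings of homoclinic loops for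
the box. Since regular points of `Λ` accumulate at `σ`, chain recurrence gives a fine chain from `σ`
to `σ` through a point outside a larger box. Run through this chain `N + 1` times and rest at `σ`
for ever before and after. A shadowing orbit must tend to `σ` at both ends and leave the box `N + 1`
times, so it is a homoclinic loop with more than `N` crossings, a contradiction. The box and `N` are
fixed before the precision of the shadowing, so the order of the quantifiers is harmless.

The box is `{S ≤ c, U ≤ c}` for two quadratic forms in a chart, positive in the stable and in the
unstable directions respectively; no invariant manifolds are needed. `S` decreases where it
dominates, `U` increases where it dominates, and `U - S` always increases away from `σ`. The last
fact gives isolation by LaSalle's principle. The first two give strict signs on the faces, so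
boundary times are isolated and homoclinic loops cross finitely often, that is, the box is adapted.

The weight is carried by `exists_lyapunov_form` and `exists_radius_lyapunov` (which yield
`exists_isolatingBox`), `IsolatingBox.finite_frontier_inter_orbit`, `exists_transGen_through`,
`exists_repeated_loop`, and the final count in `not_hasShadowingProperty_of_isolatingBox`. -/

namespace ShadowFlow

open Relation
open scoped NNReal ENNReal InnerProductSpace

/-! ### Integral curves in charts and local flows -/

section LocalFlow

variable {n : ℕ} {M : Type*} [TopologicalSpace M] [ChartedSpace (EuclideanSpace ℝ (Fin n)) M]
  [IsManifold (𝓡 n) ∞ M] {X : (x : M) → TangentSpace (𝓡 n) x}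

theorem contDiffAt_chartField (hX : IsC1VectorField X) (p : M) :
    ContDiffAt ℝ 1 (chartField X p) (extChartAt (𝓡 n) p p) := by
  have hv := hX.contMDiffAt (x := p)
  rw [contMDiffAt_iff] at hv
  exact (hv.2.contDiffAt (by simp)).snd

/-- A solution of the differential equation read in a chart is an integral curve. -/
theorem isMIntegralCurveOn_extChartAt_symm_comp {p : M} {f : ℝ → EuclideanSpace ℝ (Fin n)}
    {s : Set ℝ} (hf : ∀ t ∈ s, HasDerivAt f (chartField X p (f t)) t)
    (hs : ∀ t ∈ s, f t ∈ (extChartAt (𝓡 n) p).target) :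
    IsMIntegralCurveOn ((extChartAt (𝓡 n) p).symm ∘ f) X s := by
  intro t ht
  let q : M := (extChartAt (𝓡 n) p).symm (f t)
  let w : EuclideanSpace ℝ (Fin n) := X q
  have h : HasDerivAt f (tangentCoordChange (𝓡 n) q p q w) t := hf t ht
  have hmem := hs t ht
  have hp : q ∈ (extChartAt (𝓡 n) p).source :=
    (extChartAt (𝓡 n) p).map_target hmem
  have hq := mem_extChartAt_source (I := 𝓡 n) q
  have key : HasDerivAt ((extChartAt (𝓡 n) q ∘ (extChartAt (𝓡 n) p).symm) ∘ f) w t := by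
    rw [← tangentCoordChange_self (I := 𝓡 n) (x := q) (z := q) (v := w) hq,
      ← tangentCoordChange_comp (x := p) ⟨⟨hq, hp⟩, hq⟩]
    apply HasFDerivAt.comp_hasDerivAt _ _ h
    apply HasFDerivWithinAt.hasFDerivAt (s := range (𝓡 n)) _ (by simp)
    rw [← (extChartAt (𝓡 n) p).right_inv hmem]
    exact hasFDerivWithinAt_tangentCoordChange ⟨hp, hq⟩
  have key' : HasFDerivAt ((extChartAt (𝓡 n) q ∘ (extChartAt (𝓡 n) p).symm) ∘ f)
      ((1 : ℝ →L[ℝ] ℝ).smulRight w) t := by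
    have hw : (1 : ℝ →L[ℝ] ℝ).smulRight w = ContinuousLinearMap.toSpanSingleton ℝ w := by
      ext; simp
    rw [hw]
    exact key.hasFDerivAt
  apply HasMFDerivAt.hasMFDerivWithinAt
  exact ⟨(continuousAt_extChartAt_symm'' hmem).comp h.continuousAt, key'.hasFDerivWithinAt⟩

/-- An integral curve read in a chart solves the differential equation of the chart field. -/
theorem hasDerivAt_extChartAt_comp {p : M} {γ : ℝ → M} (hγ : IsMIntegralCurve γ X) {t : ℝ}
    (ht : γ t ∈ (extChartAt (𝓡 n) p).source) :
    HasDerivAt (extChartAt (𝓡 n) p ∘ γ) (chartField X p (extChartAt (𝓡 n) p (γ t))) t := by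
  have key : HasDerivAt (extChartAt (𝓡 n) p ∘ γ)
      (tangentCoordChange (𝓡 n) (γ t) p (γ t) (X (γ t))) t := by
    have hsrc := ht
    rw [extChartAt_source] at hsrc
    let w : EuclideanSpace ℝ (Fin n) := X (γ t)
    let A : EuclideanSpace ℝ (Fin n) →L[ℝ] EuclideanSpace ℝ (Fin n) :=
      mfderiv (𝓡 n) (𝓡 n) (chartAt (EuclideanSpace ℝ (Fin n)) p) (γ t)
    have h1 : HasFDerivAt (extChartAt (𝓡 n) p ∘ γ) (A ∘L (1 : ℝ →L[ℝ] ℝ).smulRight w) t :=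
      (HasMFDerivAt.comp t (hasMFDerivAt_extChartAt (I := 𝓡 n) hsrc) (hγ t)).hasFDerivAt
    have hA : A = tangentCoordChange (𝓡 n) (γ t) p (γ t) :=
      mfderiv_chartAt_eq_tangentCoordChange hsrc
    refine h1.hasDerivAt.congr_deriv ?_
    change A ((1 : ℝ) • w) = tangentCoordChange (𝓡 n) (γ t) p (γ t) w
    rw [one_smul, hA]
  unfold chartField
  rw [(extChartAt (𝓡 n) p).left_inv ht]
  exact key

/-- Picard–Lindelöf in a chart, with continuous dependence on the initial value, carried back to the
manifold after shrinking time and neighbourhood so that solutions stay in the chart target. -/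
theorem exists_local_flow (hX : IsC1VectorField X) (p : M) :
    ∃ U ∈ 𝓝 p, ∃ ε > (0 : ℝ), ∃ Φ : M × ℝ → M,
      (∀ x ∈ U, Φ (x, 0) = x ∧ IsMIntegralCurveOn (fun t => Φ (x, t)) X (Ioo (-ε) ε)) ∧
      ContinuousOn Φ (U ×ˢ Ioo (-ε) ε) := by
  obtain ⟨ε, hε, a, r, L, K, hr, hpl⟩ :=
    IsPicardLindelof.of_contDiffAt_one (contDiffAt_chartField hX p)
  obtain ⟨α, hα, hc⟩ :=
    (hpl 0).exists_forall_mem_closedBall_eq_hasDerivWithinAt_continuousOn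
  set e := extChartAt (𝓡 n) p with he
  set u₀ := e p with hu₀
  have hbox : Metric.closedBall u₀ r ×ˢ Icc (0 - ε) (0 + ε) ∈ 𝓝 (u₀, (0 : ℝ)) :=
    prod_mem_nhds (Metric.closedBall_mem_nhds _ hr) (Icc_mem_nhds (by linarith) (by linarith))
  have hcont : ContinuousAt α (u₀, 0) := hc.continuousAt hbox
  have hα0 : α (u₀, 0) = u₀ := (hα u₀ (Metric.mem_closedBall_self r.2)).1
  have htar : e.target ∈ 𝓝 (α (u₀, 0)) := by
    rw [hα0]; exact extChartAt_target_mem_nhds p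
  have hgood := inter_mem hbox (hcont htar)
  obtain ⟨W, hW, T, hT, hWT⟩ := mem_nhds_prod_iff.1 hgood
  obtain ⟨η, hη, hηT⟩ := Metric.mem_nhds_iff.1 hT
  rw [Real.ball_eq_Ioo] at hηT
  simp only [zero_sub, zero_add] at hηT
  have hU : e.source ∩ e ⁻¹' W ∈ 𝓝 p :=
    inter_mem (extChartAt_source_mem_nhds p) (continuousAt_extChartAt p hW)
  have hin : ∀ u ∈ W, ∀ t ∈ Ioo (-η) η, (u, t) ∈ Metric.closedBall u₀ r ×ˢ Icc (0 - ε) (0 + ε) ∩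
      α ⁻¹' e.target := fun u hu t ht => hWT ⟨hu, hηT ht⟩
  -- Only the closed interval is known to contain these times. The midpoints of `t` and `±η` give
  -- strict bounds, so that one-sided derivatives become two-sided.
  have hηε : ∀ t ∈ Ioo (-η) η, t ∈ Ioo (-ε) ε := by
    intro t ht
    have h1 := (hin u₀ (mem_of_mem_nhds hW) ((t + η) / 2)
      ⟨by linarith [ht.1, ht.2], by linarith [ht.2]⟩).1.2
    have h2 := (hin u₀ (mem_of_mem_nhds hW) ((t - η) / 2)
      ⟨by linarith [ht.1, ht.2], by linarith [ht.2, ht.1]⟩).1.2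
    constructor <;> [linarith [h2.1, ht.1]; linarith [h1.2, ht.2]]
  refine ⟨_, hU, η, hη, fun z => e.symm (α (e z.1, z.2)), ?_, ?_⟩
  · rintro x ⟨hx, hxW⟩
    have hxb := (hin _ hxW 0 ⟨by linarith, hη⟩).1.1
    refine ⟨?_, ?_⟩
    · simp only [(hα _ hxb).1]
      exact e.left_inv hx
    · refine isMIntegralCurveOn_extChartAt_symm_comp (f := fun t => α (e x, t)) ?_ ?_
      · intro t ht
        have := hηε t ht
        refine ((hα _ hxb).2 t (hin _ hxW t ht).1.2).hasDerivAt
          (Icc_mem_nhds (by linarith [this.1]) (by linarith [this.2]))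
      · exact fun t ht => (hin _ hxW t ht).2
  · have h1 : ContinuousOn (fun z : M × ℝ => (e z.1, z.2)) ((e.source ∩ e ⁻¹' W) ×ˢ Ioo (-η) η) :=
      ((continuousOn_extChartAt p).comp continuousOn_fst (fun z hz => hz.1.1)).prodMk
        continuousOn_snd
    have h2 : ContinuousOn (fun z : M × ℝ => α (e z.1, z.2))
        ((e.source ∩ e ⁻¹' W) ×ˢ Ioo (-η) η) :=
      hc.comp h1 fun z hz => (hin _ hz.1.2 _ hz.2).1
    exact (continuousOn_extChartAt_symm p).comp h2 fun z hz => (hin _ hz.1.2 _ hz.2).2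

end LocalFlow

/-! ### The global flow on a compact manifold and its continuity -/

section GlobalFlow

variable {n : ℕ} {M : Type*} [TopologicalSpace M] [ChartedSpace (EuclideanSpace ℝ (Fin n)) M]
  [IsManifold (𝓡 n) ∞ M] [CompactSpace M] {X : (x : M) → TangentSpace (𝓡 n) x}

theorem exists_uniform_time (hX : IsC1VectorField X) :
    ∃ ε > (0 : ℝ), ∀ p : M, ∃ U ∈ 𝓝 p, ∃ Φ : M × ℝ → M,
      (∀ x ∈ U, Φ (x, 0) = x ∧ IsMIntegralCurveOn (fun t => Φ (x, t)) X (Ioo (-ε) ε)) ∧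
      ContinuousOn Φ (U ×ˢ Ioo (-ε) ε) := by
  classical
  choose U hU ε hε Φ hΦ hc using exists_local_flow hX
  obtain ⟨s, hs⟩ := CompactSpace.elim_nhds_subcover (fun p => interior (U p))
    (fun p => interior_mem_nhds.2 (hU p))
  have hmin : ∃ η > (0 : ℝ), ∀ p ∈ s, η ≤ ε p := by
    clear hs
    induction s using Finset.induction_on with
    | empty => exact ⟨1, one_pos, by simp⟩
    | insert q s _ ih =>
      obtain ⟨η, hη, h⟩ := ih
      refine ⟨min η (ε q), lt_min hη (hε q), ?_⟩
      simp only [Finset.mem_insert, forall_eq_or_imp]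
      exact ⟨min_le_right _ _, fun p hp => (min_le_left _ _).trans (h p hp)⟩
  obtain ⟨η, hη, hle⟩ := hmin
  refine ⟨η, hη, fun p => ?_⟩
  have hp : p ∈ ⋃ x ∈ s, interior (U x) := hs ▸ mem_univ p
  simp only [mem_iUnion, exists_prop] at hp
  obtain ⟨q, hq, hpq⟩ := hp
  have hsub : Ioo (-η) η ⊆ Ioo (-(ε q)) (ε q) :=
    Ioo_subset_Ioo (neg_le_neg (hle q hq)) (hle q hq)
  exact ⟨U q, mem_of_superset (isOpen_interior.mem_nhds hpq) interior_subset, Φ q,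
    fun x hx => ⟨(hΦ q x hx).1, (hΦ q x hx).2.mono hsub⟩,
    (hc q).mono (prod_mono subset_rfl hsub)⟩

variable [T2Space M]

theorem exists_integralCurve (hX : IsC1VectorField X) (x : M) :
    ∃ γ : ℝ → M, γ 0 = x ∧ IsMIntegralCurve γ X := by
  obtain ⟨ε, hε, h⟩ := exists_uniform_time hX
  refine exists_isMIntegralCurve_of_isMIntegralCurveOn hX hε (fun p => ?_) x
  obtain ⟨U, hU, Φ, hΦ, -⟩ := h p
  exact ⟨fun t => Φ (p, t), hΦ p (mem_of_mem_nhds hU)⟩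

theorem flow_zero (hX : IsC1VectorField X) (x : M) : flow X 0 x = x := by
  have h := exists_integralCurve hX x
  simp only [flow, dif_pos h]
  exact h.choose_spec.1

theorem isMIntegralCurve_flow (hX : IsC1VectorField X) (x : M) :
    IsMIntegralCurve (fun t => flow X t x) X := by
  have h := exists_integralCurve hX x
  simp only [flow, dif_pos h]
  exact h.choose_spec.2

theorem flow_eq_of_isMIntegralCurve (hX : IsC1VectorField X) {γ : ℝ → M}
    (hγ : IsMIntegralCurve γ X) (t : ℝ) : flow X t (γ 0) = γ t :=
  congrFun (isMIntegralCurve_Ioo_eq_of_contMDiff_boundaryless (t₀ := 0) hX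
    (isMIntegralCurve_flow hX (γ 0)) hγ (flow_zero hX _)) t

theorem flow_add (hX : IsC1VectorField X) (s t : ℝ) (x : M) :
    flow X (s + t) x = flow X s (flow X t x) := by
  have h := flow_eq_of_isMIntegralCurve hX ((isMIntegralCurve_flow hX x).comp_add t) s
  simpa using h.symm

theorem flow_eq_self_of_isSingularity (hX : IsC1VectorField X) {p : M} (hp : IsSingularity X p)
    (t : ℝ) : flow X t p = p := by
  have hp' : X p = 0 := hp
  exact flow_eq_of_isMIntegralCurve hX (γ := fun _ => p) (isMIntegralCurve_const hp) t

/-- For small times the flow agrees with a local flow by uniqueness. A fixed time `t` is a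
composition of `k` small times `t / k`. Joint continuity near `(t, p)` follows by writing the flow
at time `s` as the time `t` map after the small time `s - t`. -/
theorem continuous_flow (hX : IsC1VectorField X) :
    Continuous (fun z : ℝ × M => flow X z.1 z.2) := by
  obtain ⟨ε, hε, h⟩ := exists_uniform_time hX
  have hsmall : ∀ (t : ℝ) (p : M), t ∈ Ioo (-ε) ε →
      ContinuousAt (fun z : ℝ × M => flow X z.1 z.2) (t, p) := by
    intro t p ht
    obtain ⟨U, hU, Φ, hΦ, hc⟩ := h p
    have h1 : ContinuousAt (fun z : ℝ × M => Φ (z.2, z.1)) (t, p) :=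
      (hc.continuousAt (prod_mem_nhds hU (Ioo_mem_nhds ht.1 ht.2))).comp
        (f := fun z : ℝ × M => (z.2, z.1)) (x := (t, p)) continuous_swap.continuousAt
    refine h1.congr ?_
    filter_upwards [prod_mem_nhds (Ioo_mem_nhds ht.1 ht.2) hU] with z hz
    refine isMIntegralCurveOn_Ioo_eqOn_of_contMDiff_boundaryless (t₀ := 0) ⟨by linarith, hε⟩ hX
      (hΦ _ hz.2).2 ((isMIntegralCurve_flow hX z.2).isMIntegralCurveOn _) ?_ hz.1
    rw [(hΦ _ hz.2).1, flow_zero hX]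
  have hfix : ∀ t : ℝ, Continuous (fun x : M => flow X t x) := by
    have hs : ∀ t ∈ Ioo (-ε) ε, Continuous (fun x : M => flow X t x) := fun t ht =>
      continuous_iff_continuousAt.2 fun p => (hsmall t p ht).comp
        (f := fun x : M => (t, x)) (x := p) (Continuous.prodMk_right t).continuousAt
    intro t
    obtain ⟨k, hk⟩ := exists_nat_gt (|t| / ε)
    have hk0 : (0 : ℝ) < k := lt_of_le_of_lt (by positivity) hk
    have hk' : t / k ∈ Ioo (-ε) ε := by
      rw [mem_Ioo, ← abs_lt, abs_div, abs_of_pos hk0, div_lt_iff₀ hk0]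
      rwa [div_lt_iff₀ hε, mul_comm] at hk
    have hmul : ∀ m : ℕ, Continuous (fun x : M => flow X (m * (t / k)) x) := by
      intro m
      induction m with
      | zero => simpa [flow_zero hX] using continuous_id'
      | succ m ih =>
        have : (fun x : M => flow X (((m + 1 : ℕ) : ℝ) * (t / k)) x) =
            fun x => flow X (m * (t / k)) (flow X (t / k) x) := by
          ext x
          rw [← flow_add hX]
          push_cast
          ring_nf
        rw [this]
        exact ih.comp (hs _ hk')
    have := hmul k
    rwa [mul_div_cancel₀ _ hk0.ne'] at this
  refine continuous_iff_continuousAt.2 fun ⟨t, p⟩ => ?_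
  have heq : (fun z : ℝ × M => flow X z.1 z.2) =
      fun z => flow X t (flow X (z.1 - t) z.2) := by
    ext z
    rw [← flow_add hX, add_sub_cancel]
  rw [heq]
  refine (hfix t).continuousAt.comp (f := fun z : ℝ × M => flow X (z.1 - t) z.2) ?_
  have := hsmall 0 p ⟨by linarith, hε⟩
  refine ContinuousAt.comp (f := fun z : ℝ × M => (z.1 - t, z.2)) (x := (t, p))
    (g := fun z : ℝ × M => flow X z.1 z.2) ?_ (by fun_prop)
  simpa using this

end GlobalFlow

/-! ### Derivative signs and LaSalle's principle -/

theorem eventually_sign_of_hasDerivAt_pos {g : ℝ → ℝ} {d t : ℝ} (hg : HasDerivAt g d t)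
    (hd : 0 < d) : (∀ᶠ τ in 𝓝[>] t, g t < g τ) ∧ ∀ᶠ τ in 𝓝[<] t, g τ < g t := by
  have h := (hasDerivAt_iff_tendsto_slope.1 hg).eventually (lt_mem_nhds hd)
  have hr : 𝓝[>] t ≤ 𝓝[≠] t := nhdsWithin_mono _ fun τ hτ => ne_of_gt hτ
  have hl : 𝓝[<] t ≤ 𝓝[≠] t := nhdsWithin_mono _ fun τ hτ => ne_of_lt hτ
  constructor
  · filter_upwards [hr h, self_mem_nhdsWithin] with τ hτ hlt
    have := (slope_pos_iff_of_le (le_of_lt hlt)).1 hτ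
    exact this
  · filter_upwards [hl h, self_mem_nhdsWithin] with τ hτ hlt
    rw [slope_comm] at hτ
    exact (slope_pos_iff_of_le (le_of_lt hlt)).1 hτ

theorem eventually_sign_of_hasDerivAt_neg {g : ℝ → ℝ} {d t : ℝ} (hg : HasDerivAt g d t)
    (hd : d < 0) : (∀ᶠ τ in 𝓝[>] t, g τ < g t) ∧ ∀ᶠ τ in 𝓝[<] t, g t < g τ := by
  have h := eventually_sign_of_hasDerivAt_pos hg.neg (neg_pos.2 hd)
  exact ⟨h.1.mono fun τ hτ => neg_lt_neg_iff.1 hτ, h.2.mono fun τ hτ => neg_lt_neg_iff.1 hτ⟩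

section Lyapunov

variable {M : Type*} [TopologicalSpace M] [T2Space M]

/-- LaSalle's principle with a single rest point: an orbit which stays in a compact set on which
`L` increases along it converges to `σ` if `σ` is the only point whose whole orbit stays in that
set with constant `L`. -/
theorem tendsto_of_monotone_lyapunov (φ : Flow ℝ M) {K : Set M} (hK : IsCompact K) {L : M → ℝ}
    (hL : ContinuousOn L K) {σ : M}
    (hσ : ∀ q, (∀ t, φ t q ∈ K) → (∀ t, L (φ t q) = L q) → q = σ) {x : M} {T : ℝ}
    (hx : ∀ t, T ≤ t → φ t x ∈ K) (hmono : MonotoneOn (fun t => L (φ t x)) (Ici T)) :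
    Tendsto (fun t => φ t x) atTop (𝓝 σ) := by
  have hev : ∀ᶠ t in atTop, φ t x ∈ K := (eventually_ge_atTop T).mono hx
  obtain ⟨ℓ, hℓ⟩ : ∃ ℓ, Tendsto (fun t => L (φ t x)) atTop (𝓝 ℓ) := by
    have hm : Monotone fun t => L (φ (max T t) x) := fun s t hst =>
      hmono (mem_Ici.2 (le_max_left _ _)) (mem_Ici.2 (le_max_left _ _)) (max_le_max le_rfl hst)
    have hb : BddAbove (range fun t => L (φ (max T t) x)) := by
      refine (hK.image_of_continuousOn hL).bddAbove.mono ?_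
      rintro _ ⟨t, rfl⟩
      exact mem_image_of_mem _ (hx _ (le_max_left _ _))
    refine ⟨_, (tendsto_atTop_ciSup hm hb).congr' ?_⟩
    filter_upwards [eventually_ge_atTop T] with t ht
    rw [max_eq_right ht]
  refine hK.le_nhds_of_unique_clusterPt (mem_map.2 hev) fun q _ hq => ?_
  -- The set of limit points is invariant: a time shift does not change the behaviour at infinity.
  have hflow : ∀ s, MapClusterPt (φ s q) atTop fun t => φ t x := by
    intro s
    have h1 : MapClusterPt (φ s q) atTop (φ s ∘ fun t => φ t x) :=
      MapClusterPt.continuousAt_comp (φ.continuous_toFun s).continuousAt hq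
    refine MapClusterPt.of_comp (φ := fun t => s + t) (p := atTop)
      (tendsto_atTop_add_const_left _ s tendsto_id) ?_
    convert h1 using 1
    ext t
    exact φ.map_add s t x
  have hmemK : ∀ s, φ s q ∈ K := fun s => hK.isClosed.mem_of_mapClusterPt (hflow s) hev
  have hval : ∀ s, L (φ s q) = ℓ := by
    intro s
    have hne : NeBot (𝓝 (φ s q) ⊓ map (fun t => φ t x) atTop) := hflow s
    -- `L` is continuous only within `K`, so the limit is taken along a filter that also remembers
    -- that the orbit is in `K`.
    have hle : 𝓝 (φ s q) ⊓ map (fun t => φ t x) atTop ≤ 𝓝[K] (φ s q) :=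
      inf_le_inf_left _ (le_principal_iff.2 hev)
    exact tendsto_nhds_unique ((hL _ (hmemK s)).mono_left hle)
      ((tendsto_map'_iff.2 hℓ).mono_left inf_le_right)
  exact hσ q hmemK fun t => by
    rw [hval t, ← hval 0, φ.map_zero_apply]

end Lyapunov

/-! ### Isolating boxes -/

/-- A box around a rest point of a flow, given by functions `S` and `U` such that `S` decreases along
the flow where `S ≥ U`, `U` increases where `U ≥ S`, and `U - S` increases everywhere, except at
the rest point. -/
structure IsolatingBox {M : Type*} [TopologicalSpace M] (φ : Flow ℝ M) (σ : M) where
  O : Set M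
  S : M → ℝ
  U : M → ℝ
  r : ℝ
  isOpen : IsOpen O
  mem : σ ∈ O
  contS : ContinuousOn S O
  contU : ContinuousOn U O
  S_rest : S σ = 0
  U_rest : U σ = 0
  r_pos : 0 < r
  compact : IsCompact {x ∈ O | S x ≤ r ∧ U x ≤ r}
  deriv_zero : ∀ x ∈ O, S x ≤ r → U x ≤ r → ∃ s u : ℝ, HasDerivAt (fun t => S (φ t x)) s 0 ∧
    HasDerivAt (fun t => U (φ t x)) u 0 ∧
    (x ≠ σ → (U x ≤ S x → s < 0) ∧ (S x ≤ U x → 0 < u) ∧ s < u)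

namespace IsolatingBox

variable {M : Type*} [TopologicalSpace M] {φ : Flow ℝ M} {σ : M} (B : IsolatingBox φ σ)

/-- The box of size `c`. -/
def box (c : ℝ) : Set M := {x ∈ B.O | B.S x ≤ c ∧ B.U x ≤ c}

/-- The open box of size `c`. -/
def openBox (c : ℝ) : Set M := {x ∈ B.O | B.S x < c ∧ B.U x < c}

theorem isOpen_openBox (c : ℝ) : IsOpen (B.openBox c) := by
  have h := (B.contS.prodMk B.contU).isOpen_inter_preimage B.isOpen
    (isOpen_Iio.prod isOpen_Iio : IsOpen (Iio c ×ˢ Iio c : Set (ℝ × ℝ)))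
  exact h

theorem openBox_subset_box (c : ℝ) : B.openBox c ⊆ B.box c :=
  fun _ hx => ⟨hx.1, hx.2.1.le, hx.2.2.le⟩

theorem openBox_subset_interior (c : ℝ) : B.openBox c ⊆ interior (B.box c) :=
  interior_maximal (B.openBox_subset_box c) (B.isOpen_openBox c)

theorem rest_mem_openBox {c : ℝ} (hc : 0 < c) : σ ∈ B.openBox c :=
  ⟨B.mem, by rwa [B.S_rest], by rwa [B.U_rest]⟩

theorem box_mem_nhds {c : ℝ} (hc : 0 < c) : B.box c ∈ 𝓝 σ :=
  mem_interior_iff_mem_nhds.1 (B.openBox_subset_interior c (B.rest_mem_openBox hc))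

theorem box_subset_openBox {c d : ℝ} (h : c < d) : B.box c ⊆ B.openBox d :=
  fun _ hx => ⟨hx.1, hx.2.1.trans_lt h, hx.2.2.trans_lt h⟩

theorem box_mono {c d : ℝ} (h : c ≤ d) : B.box c ⊆ B.box d :=
  fun _ hx => ⟨hx.1, hx.2.1.trans h, hx.2.2.trans h⟩

theorem isCompact_box [T2Space M] {c : ℝ} (hc : c ≤ B.r) : IsCompact (B.box c) := by
  have hcont : ContinuousOn (fun x => (B.S x, B.U x)) (B.box B.r) :=
    (B.contS.prodMk B.contU).mono fun x hx => hx.1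
  have h := hcont.preimage_isClosed_of_isClosed B.compact.isClosed
    (isClosed_Iic.prod isClosed_Iic : IsClosed (Iic c ×ˢ Iic c : Set (ℝ × ℝ)))
  refine B.compact.of_isClosed_subset (?_ : IsClosed (B.box c)) (B.box_mono hc)
  convert h using 1
  ext x
  exact ⟨fun hx => ⟨B.box_mono hc hx, hx.2⟩, fun hx => ⟨hx.1.1, hx.2⟩⟩

theorem hasDerivAt {x : M} {t : ℝ} (hx : φ t x ∈ B.box B.r) :
    ∃ s u : ℝ, HasDerivAt (fun τ => B.S (φ τ x)) s t ∧ HasDerivAt (fun τ => B.U (φ τ x)) u t ∧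
    (φ t x ≠ σ → (B.U (φ t x) ≤ B.S (φ t x) → s < 0) ∧ (B.S (φ t x) ≤ B.U (φ t x) → 0 < u) ∧
      s < u) := by
  obtain ⟨s, u, hs, hu, h⟩ := B.deriv_zero _ hx.1 hx.2.1 hx.2.2
  have key : ∀ (F : M → ℝ) (d : ℝ), HasDerivAt (fun τ => F (φ τ (φ t x))) d 0 →
      HasDerivAt (fun τ => F (φ τ x)) d t := by
    intro F d hd
    have h1 : HasDerivAt (fun τ => F (φ τ (φ t x))) d (t - t) := by rwa [sub_self]
    have h2 : (fun τ => F (φ τ x)) = fun τ => F (φ (τ - t) (φ t x)) := by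
      ext τ
      rw [← φ.map_add, sub_add_cancel]
    rw [h2]
    exact h1.comp_sub_const t t
  exact ⟨s, u, key _ _ hs, key _ _ hu, h⟩

theorem continuousOn_sub : ContinuousOn (fun x => B.U x - B.S x) (B.box B.r) :=
  (B.contU.sub B.contS).mono fun _ hx => hx.1

variable (hσ : ∀ t, φ t σ = σ)
include hσ

/-- `U - S` increases along the flow in the box. -/
theorem deriv_sub_nonneg {x : M} {t : ℝ} (hx : φ t x ∈ B.box B.r) :
    ∃ d, HasDerivAt (fun τ => B.U (φ τ x) - B.S (φ τ x)) d t ∧ 0 ≤ d ∧ (d = 0 → φ t x = σ) := by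
  obtain ⟨s, u, hs, hu, h⟩ := B.hasDerivAt hx
  by_cases hne : φ t x = σ
  · have hconst : ∀ τ, φ τ x = σ := by
      intro τ
      have : φ τ x = φ (τ - t) (φ t x) := by rw [← φ.map_add, sub_add_cancel]
      rw [this, hne, hσ]
    refine ⟨0, ?_, le_rfl, fun _ => hne⟩
    simp only [hconst]
    exact hasDerivAt_const _ _
  · exact ⟨u - s, hu.sub hs, (sub_pos.2 (h hne).2.2).le, fun h0 =>
      absurd h0 (sub_pos.2 (h hne).2.2).ne'⟩

theorem monotoneOn_sub {x : M} {D : Set ℝ} (hD : Convex ℝ D)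
    (hx : ∀ t ∈ D, φ t x ∈ B.box B.r) :
    MonotoneOn (fun τ => B.U (φ τ x) - B.S (φ τ x)) D := by
  choose! d hd h0 _ using fun t (ht : t ∈ D) => B.deriv_sub_nonneg hσ (hx t ht)
  refine monotoneOn_of_deriv_nonneg hD (fun t ht => (hd t ht).continuousAt.continuousWithinAt)
    (fun t ht => (hd t (interior_subset ht)).differentiableAt.differentiableWithinAt)
    fun t ht => ?_
  rw [(hd t (interior_subset ht)).deriv]
  exact h0 t (interior_subset ht)

theorem eq_rest_of_const {q : M} (hq : ∀ t, φ t q ∈ B.box B.r)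
    (hc : ∀ t, B.U (φ t q) - B.S (φ t q) = B.U q - B.S q) : q = σ := by
  obtain ⟨d, hd, -, h⟩ := B.deriv_sub_nonneg hσ (hq 0)
  have h0 : d = 0 := by
    simp only [hc] at hd
    exact hd.unique (hasDerivAt_const _ _)
  simpa using h h0

variable [T2Space M]

theorem tendsto_atTop {x : M} {T : ℝ} (hx : ∀ t, T ≤ t → φ t x ∈ B.box B.r) :
    Tendsto (fun t => φ t x) atTop (𝓝 σ) :=
  tendsto_of_monotone_lyapunov φ (B.isCompact_box le_rfl) (B.continuousOn_sub)
    (fun _ => B.eq_rest_of_const hσ) hx (B.monotoneOn_sub hσ (convex_Ici T) hx)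

/-- LaSalle's principle for the reversed flow, along which `-(U - S)` increases. -/
theorem tendsto_atBot {x : M} {T : ℝ} (hx : ∀ t, t ≤ T → φ t x ∈ B.box B.r) :
    Tendsto (fun t => φ t x) atBot (𝓝 σ) := by
  have h : Tendsto (fun t => φ.reverse t x) atTop (𝓝 σ) := by
    refine tendsto_of_monotone_lyapunov φ.reverse (B.isCompact_box le_rfl)
      (L := fun x => -(B.U x - B.S x)) (B.continuousOn_sub).neg ?_ (T := -T) ?_ ?_
    · intro q hq hc
      refine B.eq_rest_of_const hσ (fun t => ?_) fun t => ?_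
      · simpa using hq (-t)
      · simpa [-neg_sub] using hc (-t)
    · intro t ht
      exact hx _ (by linarith)
    · intro s hs t ht hst
      simp only [mem_Ici] at hs ht
      exact neg_le_neg (B.monotoneOn_sub hσ (convex_Iic T) hx (by simp; linarith)
        (by simp; linarith) (neg_le_neg hst))
  have h2 := h.comp tendsto_neg_atBot_atTop
  simpa [Function.comp_def] using h2

/-- Such an orbit tends to `σ` at both ends, so the monotone function `U - S` has limit `0` at both
ends and vanishes along it; only the rest point allows a constant value. -/
theorem eq_rest {x : M} (hx : ∀ t, φ t x ∈ B.box B.r) : x = σ := by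
  have hmono := B.monotoneOn_sub hσ convex_univ fun t _ => hx t
  have hm : Monotone fun t => B.U (φ t x) - B.S (φ t x) := fun s t h =>
    hmono (mem_univ _) (mem_univ _) h
  have hcont : ContinuousAt (fun y => B.U y - B.S y) σ :=
    (B.contU.sub B.contS).continuousAt (B.isOpen.mem_nhds B.mem)
  have h0 : B.U σ - B.S σ = 0 := by rw [B.U_rest, B.S_rest, sub_zero]
  have htop : Tendsto (fun t => B.U (φ t x) - B.S (φ t x)) atTop (𝓝 0) := by
    have := hcont.tendsto.comp (B.tendsto_atTop hσ (T := 0) fun t _ => hx t)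
    rwa [h0] at this
  have hbot : Tendsto (fun t => B.U (φ t x) - B.S (φ t x)) atBot (𝓝 0) := by
    have := hcont.tendsto.comp (B.tendsto_atBot hσ (T := 0) fun t _ => hx t)
    rwa [h0] at this
  have hz : ∀ t, B.U (φ t x) - B.S (φ t x) = 0 := fun t =>
    le_antisymm (hm.ge_of_tendsto htop t) (hm.le_of_tendsto hbot t)
  refine B.eq_rest_of_const hσ hx fun t => ?_
  have := hz 0
  rw [φ.map_zero_apply] at this
  rw [hz t, this]

/-- The times at which a nonconstant orbit meets the boundary of a box are isolated. -/
theorem eventually_notMem_frontier {c : ℝ} (hc : 0 < c) (hcr : c ≤ B.r) {x : M} {t : ℝ}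
    (ht : φ t x ∈ frontier (B.box c)) : ∀ᶠ τ in 𝓝[≠] t, φ τ x ∉ frontier (B.box c) := by
  have hcl : IsClosed (B.box c) := (B.isCompact_box hcr).isClosed
  have hmem : φ t x ∈ B.box c := hcl.frontier_subset ht
  have hne : φ t x ≠ σ := by
    intro h
    exact ht.2 (B.openBox_subset_interior c (h ▸ B.rest_mem_openBox hc))
  have hnot : φ t x ∉ B.openBox c := fun h => ht.2 (B.openBox_subset_interior c h)
  obtain ⟨s, u, hs, hu, h⟩ := B.hasDerivAt (B.box_mono hcr hmem)
  obtain ⟨h1, h2, -⟩ := h hne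
  have hO : ∀ᶠ τ in 𝓝 t, φ τ x ∈ B.O :=
    (φ.continuous continuous_id continuous_const).continuousAt.eventually
      (B.isOpen.mem_nhds hmem.1)
  have hin : ∀ τ, φ τ x ∈ B.openBox c → φ τ x ∉ frontier (B.box c) :=
    fun τ h h' => h'.2 (B.openBox_subset_interior c h)
  have hout : ∀ τ, φ τ x ∉ B.box c → φ τ x ∉ frontier (B.box c) :=
    fun τ h h' => h (hcl.frontier_subset h')
  have hSe : ∀ l ≤ 𝓝 t, B.S (φ t x) < c → ∀ᶠ τ in l, B.S (φ τ x) < c := fun l hl h =>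
    hl (hs.continuousAt.eventually (gt_mem_nhds h))
  have hUe : ∀ l ≤ 𝓝 t, B.U (φ t x) < c → ∀ᶠ τ in l, B.U (φ τ x) < c := fun l hl h =>
    hl (hu.continuousAt.eventually (gt_mem_nhds h))
  rw [← Iio_union_Ioi, nhdsWithin_union, eventually_sup]
  -- Just before `t`: on the face `S = c` the orbit comes from outside since `S` decreases,
  -- otherwise `U = c` and it comes from the open box. Just after `t` the roles are exchanged.
  -- Testing `S` first on the left and `U` first on the right settles the corner `S = U = c`.
  constructor
  · rcases eq_or_lt_of_le hmem.2.1 with hS | hS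
    · have := (eventually_sign_of_hasDerivAt_neg hs (h1 (hS ▸ hmem.2.2))).2
      filter_upwards [this] with τ hτ
      exact hout τ fun h => absurd h.2.1 (not_le.2 (hS ▸ hτ))
    · rcases eq_or_lt_of_le hmem.2.2 with hU | hU
      · have := (eventually_sign_of_hasDerivAt_pos hu (h2 (hU ▸ hS.le))).2
        filter_upwards [this, hSe _ nhdsWithin_le_nhds hS, nhdsWithin_le_nhds hO] with τ h1 h2 h3
        exact hin τ ⟨h3, h2, hU ▸ h1⟩
      · exact absurd ⟨hmem.1, hS, hU⟩ hnot
  · rcases eq_or_lt_of_le hmem.2.2 with hU | hU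
    · have := (eventually_sign_of_hasDerivAt_pos hu (h2 (hU ▸ hmem.2.1))).1
      filter_upwards [this] with τ hτ
      exact hout τ fun h => absurd h.2.2 (not_le.2 (hU ▸ hτ))
    · rcases eq_or_lt_of_le hmem.2.1 with hS | hS
      · have := (eventually_sign_of_hasDerivAt_neg hs (h1 (hS ▸ hU.le))).1
        filter_upwards [this, hUe _ nhdsWithin_le_nhds hU, nhdsWithin_le_nhds hO] with τ h1 h2 h3
        exact hin τ ⟨h3, hS ▸ h1, h2⟩
      · exact absurd ⟨hmem.1, hS, hU⟩ hnot

/-- An orbit homoclinic to the rest point meets the boundary of a box in finitely many points. -/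
theorem finite_frontier_inter_orbit {c : ℝ} (hc : 0 < c) (hcr : c ≤ B.r) {x : M}
    (htop : Tendsto (fun t => φ t x) atTop (𝓝 σ)) (hbot : Tendsto (fun t => φ t x) atBot (𝓝 σ)) :
    (frontier (B.box c) ∩ range fun t => φ t x).Finite := by
  set T := {t | φ t x ∈ frontier (B.box c)} with hT
  have hint : interior (B.box c) ∈ 𝓝 σ := interior_mem_nhds.2 (B.box_mem_nhds hc)
  obtain ⟨b, hb⟩ := eventually_atTop.1 (htop hint)
  obtain ⟨a, ha⟩ := eventually_atBot.1 (hbot hint)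
  have hsub : T ⊆ Icc a b := by
    intro t ht
    constructor
    · by_contra! h
      exact ht.2 (ha t h.le)
    · by_contra! h
      exact ht.2 (hb t h.le)
  have hTcl : IsClosed T :=
    isClosed_frontier.preimage (φ.continuous continuous_id continuous_const)
  have hfin : T.Finite := by
    -- An infinite closed set of times in `Icc a b` would accumulate at one of its own points, but
    -- boundary times are isolated.
    by_contra hinf
    obtain ⟨t, -, ht⟩ := Set.Infinite.exists_accPt_of_subset_isCompact hinf isCompact_Icc hsub
    have htT : t ∈ T := hTcl.closure_subset (mem_closure_iff_clusterPt.2 ht.clusterPt)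
    have := B.eventually_notMem_frontier hσ hc hcr htT
    exact (accPt_iff_frequently_nhdsNE.1 ht) (this.mono fun τ h h' => h h')
  refine (hfin.image fun t => φ t x).subset ?_
  rintro _ ⟨hy, t, rfl⟩
  exact ⟨t, hy, rfl⟩

end IsolatingBox

/-! ### Chains in a chain-recurrent set -/

section Chains

variable {M : Type*} [EMetricSpace M]

/-- There is a jump of size at most `δ` from the orbit of `p` to `q` after a time at least `1`. -/
def ChainStep (φ : Flow ℝ M) (Λ : Set M) (δ : ℝ≥0∞) (p q : M) : Prop :=
  p ∈ Λ ∧ q ∈ Λ ∧ ∃ t : ℝ, 1 ≤ t ∧ edist (φ t p) q ≤ δ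

variable {φ : Flow ℝ M} {Λ : Set M} {δ : ℝ≥0∞}

theorem exists_uniform_edist_flow [CompactSpace M] (φ : Flow ℝ M) (K : ℝ) (hδ : 0 < δ) :
    ∃ ε > 0, ∀ s ∈ Icc (-K) K, ∀ x y, edist x y ≤ ε → edist (φ s x) (φ s y) ≤ δ := by
  have hc : Continuous fun z : Icc (-K) K × M => φ z.1 z.2 := φ.continuous (by fun_prop) (by fun_prop)
  have hu := CompactSpace.uniformContinuous_of_continuous hc
  obtain ⟨ε, hε, h⟩ := EMetric.uniformContinuous_iff.1 hu δ hδ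
  obtain ⟨η, hη, hηε⟩ := exists_between hε
  refine ⟨η, hη, fun s hs x y hxy => ?_⟩
  refine (h (a := (⟨s, hs⟩, x)) (b := (⟨s, hs⟩, y)) ?_).le
  rw [Prod.edist_eq, edist_self]
  simpa using hxy.trans_lt hηε

variable [CompactSpace M]

/-- A chain from `p` to itself, translated by time `-s`, ends at `φ (-s) p`. To start it at `p`
itself, the second step is shortened by `s`; if that could leave it shorter than `1`, it is merged
with the first step, whose error is then carried only over a bounded time. -/
theorem transGen_chainStep_back (hinv : ∀ t, ∀ x ∈ Λ, φ t x ∈ Λ)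
    (hrec : ∀ p ∈ Λ, ∀ ε > 0, TransGen (ChainStep φ Λ ε) p p) {p : M} (hp : p ∈ Λ) (hδ : 0 < δ)
    {s : ℝ} (hs : s ∈ Icc (0 : ℝ) 1) : TransGen (ChainStep φ Λ δ) p (φ (-s) p) := by
  obtain ⟨ε₁, hε₁, h₁⟩ := exists_uniform_edist_flow φ 2 (ENNReal.half_pos hδ.ne')
  set ε := min ε₁ δ with hε
  have hcont : ∀ τ ∈ Icc (-2 : ℝ) 2, ∀ x y, edist x y ≤ ε → edist (φ τ x) (φ τ y) ≤ δ / 2 :=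
    fun τ hτ x y hxy => h₁ τ hτ x y (hxy.trans (min_le_left _ _))
  have hhalf : δ / 2 ≤ δ := ENNReal.half_le_self
  have hsm : -s ∈ Icc (-2 : ℝ) 2 := ⟨by linarith [hs.2], by linarith [hs.1]⟩
  have hshift : ∀ a b, ChainStep φ Λ ε a b → ChainStep φ Λ δ (φ (-s) a) (φ (-s) b) := by
    rintro a b ⟨ha, hb, t, ht, hab⟩
    refine ⟨hinv _ _ ha, hinv _ _ hb, t, ht, ?_⟩
    rw [← φ.map_add, add_comm, φ.map_add]
    exact (hcont _ hsm _ _ hab).trans hhalf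
  have htwo : ∀ a b c, ChainStep φ Λ ε a b → ChainStep φ Λ ε b c →
      TransGen (ChainStep φ Λ δ) a (φ (-s) c) := by
    rintro a b c ⟨ha, hb, t, ht, hab⟩ ⟨-, hc, t', ht', hbc⟩
    have hbc' : edist (φ (t' - s) b) (φ (-s) c) ≤ δ / 2 := by
      rw [sub_eq_neg_add, φ.map_add]
      exact hcont _ hsm _ _ hbc
    rcases le_total 2 t' with h2 | h2
    · refine TransGen.tail (.single ⟨ha, hb, t, ht, hab.trans (min_le_right _ _)⟩)
        ⟨hb, hinv _ _ hc, t' - s, by linarith [hs.2], hbc'.trans hhalf⟩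
    · refine .single ⟨ha, hinv _ _ hc, (t' - s) + t, by linarith [hs.2], ?_⟩
      rw [φ.map_add]
      calc edist (φ (t' - s) (φ t a)) (φ (-s) c)
          ≤ edist (φ (t' - s) (φ t a)) (φ (t' - s) b) + edist (φ (t' - s) b) (φ (-s) c) :=
            edist_triangle _ _ _
        _ ≤ δ / 2 + δ / 2 :=
            add_le_add (hcont _ ⟨by linarith [hs.2], by linarith [hs.1]⟩ _ _ hab) hbc'
        _ = δ := ENNReal.add_halves δ
  have hpp := hrec p hp ε (lt_min hε₁ hδ)
  -- The chain may have a single step, so it is followed by another copy of itself to ensure a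
  -- second one.
  obtain ⟨b, hpb, hbp⟩ := TransGen.head'_iff.1 hpp
  obtain ⟨c, hbc, hcp⟩ := TransGen.head'_iff.1 (TransGen.trans_right hbp hpp)
  exact TransGen.trans_left (htwo p b c hpb hbc) (hcp.lift (fun x => φ (-s) x) hshift)

/-- Moving along the orbit for a long time `T` is one step; going back from `T` to `t` is done in
`k` backward moves of length at most `1`. -/
theorem transGen_chainStep_flow (hinv : ∀ t, ∀ x ∈ Λ, φ t x ∈ Λ)
    (hrec : ∀ p ∈ Λ, ∀ ε > 0, TransGen (ChainStep φ Λ ε) p p) {p : M} (hp : p ∈ Λ) (hδ : 0 < δ)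
    (t : ℝ) : TransGen (ChainStep φ Λ δ) p (φ t p) := by
  have hback : ∀ s ∈ Icc (0 : ℝ) 1, ∀ m : ℕ, ∀ q ∈ Λ,
      TransGen (ChainStep φ Λ δ) q (φ (-(m * s)) q) := by
    intro s hs m
    induction m with
    | zero =>
      intro q hq
      simpa using hrec q hq δ hδ
    | succ m ih =>
      intro q hq
      have h := (ih q hq).trans (transGen_chainStep_back hinv hrec (hinv _ _ hq) hδ hs)
      rw [← φ.map_add] at h
      convert h using 2
      push_cast
      ring
  set T := |t| + 1 with hT
  have h1 : TransGen (ChainStep φ Λ δ) p (φ T p) :=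
    .single ⟨hp, hinv _ _ hp, T, by simp [hT], by simp⟩
  have hTt : 0 < T - t := by linarith [le_abs_self t]
  obtain ⟨k, hk⟩ := exists_nat_ge (T - t)
  have hk0 : (0 : ℝ) < k := hTt.trans_le hk
  have h2 := hback ((T - t) / k) ⟨by positivity, (div_le_one hk0).2 hk⟩ k _ (hinv T _ hp)
  rw [mul_div_cancel₀ _ hk0.ne', ← φ.map_add] at h2
  convert h1.trans h2 using 2
  ring

/-- Near a rest point of a chain recurrent set which is approximated by points of the set, there is
a chain from the rest point to the rest point through any given point of the orbit of such a
point. -/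
theorem exists_transGen_through (hinv : ∀ t, ∀ x ∈ Λ, φ t x ∈ Λ)
    (hrec : ∀ p ∈ Λ, ∀ ε > 0, TransGen (ChainStep φ Λ ε) p p) {σ : M} (hσΛ : σ ∈ Λ)
    (hσ : ∀ t, φ t σ = σ) {A : Set M} (hA : A ⊆ Λ) (hσA : σ ∈ closure A) (hδ : 0 < δ) :
    ∃ x ∈ A, ∀ t, TransGen (ChainStep φ Λ δ) σ (φ t x) ∧ TransGen (ChainStep φ Λ δ) (φ t x) σ := by
  have h1 : ∀ᶠ x in 𝓝 σ, edist (φ 1 σ) x ≤ δ := by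
    rw [hσ]
    filter_upwards [Metric.closedEBall_mem_nhds σ hδ] with x hx
    rwa [edist_comm]
  have h2 : ∀ᶠ x in 𝓝 σ, edist (φ 1 x) σ ≤ δ := by
    have h := (φ.continuous_toFun 1).tendsto σ
    rw [hσ] at h
    exact h.eventually (Metric.closedEBall_mem_nhds σ hδ)
  obtain ⟨x, hxA, h1, h2⟩ := ((mem_closure_iff_frequently.1 hσA).and_eventually (h1.and h2)).exists
  have hx := hA hxA
  refine ⟨x, hxA, fun t => ⟨TransGen.head ⟨hσΛ, hx, 1, le_rfl, h1⟩
    (transGen_chainStep_flow hinv hrec hx hδ t), ?_⟩⟩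
  have h3 := transGen_chainStep_flow hinv hrec (hinv t _ hx) hδ (-t)
  rw [← φ.map_add, neg_add_cancel, φ.map_zero_apply] at h3
  exact h3.tail ⟨hx, hσΛ, 1, le_rfl, h2⟩

end Chains

/-! ### Chains and repeated loops as sequences -/

section Sequences

theorem exists_seq_of_transGen {α : Type*} {r : α → α → Prop} {a b : α} (h : TransGen r a b) :
    ∃ (m : ℕ) (u : ℕ → α), 0 < m ∧ u 0 = a ∧ u m = b ∧ ∀ i < m, r (u i) (u (i + 1)) := by
  induction h with
  | @single c hc =>
    exact ⟨1, fun i => if i = 0 then a else c, one_pos, by simp, by simp, by simpa using hc⟩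
  | @tail c d _ hcd ih =>
    obtain ⟨m, u, hm, h0, h1, hu⟩ := ih
    refine ⟨m + 1, fun i => if i ≤ m then u i else d, by omega, by simpa using h0, by simp, ?_⟩
    intro i hi
    rcases Nat.lt_succ_iff_lt_or_eq.1 hi with h | rfl
    · simpa [h.le, Nat.succ_le_of_lt h] using hu i h
    · simpa [h1] using hcd

theorem exists_loop_of_transGen {α : Type*} {r : α → α → Prop} {a b : α} (hab : TransGen r a b)
    (hba : TransGen r b a) : ∃ (k m : ℕ) (u : ℕ → α), 0 < k ∧ k < m ∧ u 0 = a ∧ u k = b ∧ u m = a ∧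
      ∀ i < m, r (u i) (u (i + 1)) := by
  obtain ⟨k, u, hk, h0, h1, hu⟩ := exists_seq_of_transGen hab
  obtain ⟨l, v, hl, g0, g1, hv⟩ := exists_seq_of_transGen hba
  refine ⟨k, k + l, fun i => if i < k then u i else v (i - k), hk, by omega, by simp [hk, h0],
    by simp [g0], by simp [g1], fun i hi => ?_⟩
  rcases lt_trichotomy (i + 1) k with h | h | h
  · simpa [h, (Nat.lt_succ_self i).trans h] using hu i (by omega)
  · have hik : i < k := by omega
    have := hu i hik
    simp only [hik, if_true, h, lt_irrefl, if_false, Nat.sub_self, g0]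
    rwa [h, h1] at this
  · have h1 : ¬ i < k := by omega
    have h2 : ¬ i + 1 < k := by omega
    simp only [h1, h2, if_false]
    have := hv (i - k) (by omega)
    rwa [show i + 1 - k = i - k + 1 by omega]

/-- A bi-infinite sequence which runs `N` times through a loop at `a` and rests at `a` before and
afterwards. -/
theorem exists_repeated_loop {α : Type*} {r : α → α → Prop} {a b : α} (haa : r a a)
    (hab : TransGen r a b) (hba : TransGen r b a) (N : ℕ) :
    ∃ (x : ℤ → α) (k m : ℤ), 0 < k ∧ k < m ∧ (∀ i, r (x i) (x (i + 1))) ∧ (∀ i ≤ 0, x i = a) ∧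
      (∀ i, N * m ≤ i → x i = a) ∧ (∀ j : ℕ, j ≤ N → x (j * m) = a) ∧
      ∀ j : ℕ, j < N → x (j * m + k) = b := by
  obtain ⟨k, m, u, hk, hkm, h0, h1, h2, hu⟩ := exists_loop_of_transGen hab hba
  have hm : (0 : ℤ) < m := by omega
  -- The loop is continued periodically on `[0, N * m)` and replaced by `a` elsewhere; the two rules
  -- match because the loop begins and ends at `a`.
  set x : ℤ → α := fun i => if 0 ≤ i ∧ i < N * m then u (i % m).toNat else a with hx
  have hle : ∀ i ≤ 0, x i = a := by
    intro i hi
    simp only [hx]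
    split_ifs with h
    · obtain rfl : i = 0 := le_antisymm hi h.1
      simpa using h0
    · rfl
  have hge : ∀ i, (N : ℤ) * m ≤ i → x i = a := by
    intro i hi
    simp only [hx]
    rw [if_neg (by omega)]
  refine ⟨x, k, m, by omega, by omega, fun i => ?_, hle, hge, fun j hj => ?_, fun j hj => ?_⟩
  · rcases lt_or_ge i 0 with hi | hi
    · rwa [hle i hi.le, hle (i + 1) (by omega)]
    rcases le_or_gt ((N : ℤ) * m) i with hi' | hi'
    · rwa [hge i hi', hge (i + 1) (by omega)]
    have e1 : x i = u (i % m).toNat := if_pos ⟨hi, hi'⟩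
    have hmod := Int.emod_nonneg i hm.ne'
    have hlt := Int.emod_lt_of_pos i hm
    have hstep := hu (i % m).toNat (by omega)
    have e2 : x (i + 1) = u ((i % m).toNat + 1) := by
      -- Either a turn closes at `i + 1`, where the value is `a` on both sides even when the turn
      -- was the last one, or the position within the turn simply advances.
      rcases eq_or_lt_of_le (Int.add_one_le_iff.2 hlt) with h | h
      · have hz : (i + 1) % m = 0 := by
          rw [← Int.emod_add_emod, h]
          simp
        have : (i % m).toNat + 1 = m := by omega
        rw [this, h2]
        simp only [hx]
        split_ifs
        · simpa [hz] using h0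
        · rfl
      · have hz : (i + 1) % m = i % m + 1 := by
          rw [← Int.emod_add_emod, Int.emod_eq_of_lt (by omega) h]
        have hlt2 : i + 1 < N * m := by
          by_contra hcon
          have : i + 1 = N * m := by omega
          rw [this, Int.mul_emod_left] at hz
          omega
        simp only [hx]
        rw [if_pos ⟨by omega, hlt2⟩, hz]
        congr 1
        omega
    rw [e1, e2]
    exact hstep
  · simp only [hx]
    split_ifs
    · simpa using h0
    · rfl
  · have h3 : ((j : ℤ) * m + k) < N * m := by
      have : ((j : ℤ) + 1) * m ≤ N * m := mul_le_mul_of_nonneg_right (by omega) hm.le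
      linarith [show (k : ℤ) < m by omega]
    have h4 : (0 : ℤ) ≤ j * m + k := by positivity
    simp only [hx]
    rw [if_pos ⟨h4, h3⟩, Int.mul_add_emod_self_right, Int.emod_eq_of_lt (by omega) (by omega)]
    simpa using h1

end Sequences

/-! ### Counting boundary crossings -/

section Crossings

variable {M : Type*} [TopologicalSpace M]

/-- Otherwise the interior and the complement of the closure would disconnect the time interval. -/
theorem exists_mem_frontier_of_continuous {γ : ℝ → M} (hγ : Continuous γ) {V : Set M}
    {a b : ℝ} (hab : a ≤ b) (ha : γ a ∈ interior V) (hb : γ b ∉ closure V) :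
    ∃ t ∈ Ioo a b, γ t ∈ frontier V := by
  by_contra! hcon
  have hsub : Icc a b ⊆ γ ⁻¹' interior V ∪ γ ⁻¹' (closure V)ᶜ := by
    intro t ht
    by_contra hn
    simp only [mem_union, mem_preimage, mem_compl_iff, not_or, not_not] at hn
    have hta : t ≠ a := fun h => hn.1 (h ▸ ha)
    have htb : t ≠ b := fun h => hb (h ▸ hn.2)
    exact hcon t ⟨lt_of_le_of_ne ht.1 hta.symm, lt_of_le_of_ne ht.2 htb⟩ ⟨hn.2, hn.1⟩
  obtain ⟨t, -, h1, h2⟩ := isPreconnected_Icc _ _ (isOpen_interior.preimage hγ)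
    (isClosed_closure.isOpen_compl.preimage hγ) hsub ⟨a, left_mem_Icc.2 hab, ha⟩
    ⟨b, right_mem_Icc.2 hab, hb⟩
  exact h2 (interior_subset_closure h1)

/-- An injective curve which leaves `V` at least `N` times meets the boundary of `V` at least `N`
times. -/
theorem le_encard_frontier_inter_range {γ : ℝ → M} (hγ : Continuous γ)
    (hinj : Function.Injective γ) {V : Set M} {N : ℕ} {a b : ℕ → ℝ} (hab : ∀ j < N, a j ≤ b j)
    (hba : ∀ i j, i < j → j < N → b i ≤ a j) (ha : ∀ j < N, γ (a j) ∈ interior V)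
    (hb : ∀ j < N, γ (b j) ∉ closure V) : (N : ℕ∞) ≤ (frontier V ∩ range γ).encard := by
  choose! t ht hf using fun j (hj : j < N) =>
    exists_mem_frontier_of_continuous hγ (hab j hj) (ha j hj) (hb j hj)
  have hlt : ∀ i j, i < j → j < N → t i < t j := fun i j hij hj =>
    (ht i (hij.trans hj)).2.trans_le ((hba i j hij hj).trans (ht j hj).1.le)
  have hti : Function.Injective fun j : Fin N => γ (t j) := by
    intro i j hij
    have h := hinj hij
    by_contra hne
    rcases lt_or_gt_of_ne hne with h' | h'
    · exact (hlt i j h' j.2).ne h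
    · exact (hlt j i h' i.2).ne' h
  calc (N : ℕ∞) ≤ (range fun j : Fin N => γ (t j)).encard := by
        simpa using hti.encard_range
    _ ≤ _ := encard_le_encard (by
        rintro _ ⟨j, rfl⟩
        exact ⟨hf j j.2, mem_range_self _⟩)

end Crossings

/-! ### Starting times of pseudo-orbits -/

theorem startTime_strictMono {t : ℤ → ℝ} (ht : ∀ i, 1 ≤ t i) : StrictMono (startTime t) :=
  strictMono_int_of_lt_succ fun i => by
    rw [startTime_succ]
    linarith [ht i]

/-- Pieces of length at least `1` force the starting times to be unbounded on both sides, so there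
is a last one not exceeding `τ`. -/
theorem exists_mem_Ico_startTime {t : ℤ → ℝ} (ht : ∀ i, 1 ≤ t i) (τ : ℝ) :
    ∃ i, τ ∈ Ico (startTime t i) (startTime t (i + 1)) := by
  have hge : ∀ k : ℕ, (k : ℝ) ≤ startTime t k := by
    intro k
    induction k with
    | zero => simp [startTime_zero]
    | succ k ih =>
      push_cast
      rw [startTime_succ]
      linarith [ht k]
  have hle : ∀ k : ℕ, startTime t (-k) ≤ -k := by
    intro k
    induction k with
    | zero => simp [startTime_zero]
    | succ k ih =>
      have h := startTime_succ t (-(k + 1 : ℕ))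
      rw [show (-((k + 1 : ℕ) : ℤ) + 1) = -k by push_cast; ring] at h
      push_cast at h ⊢
      linarith [ht (-(k + 1 : ℤ))]
  have hm := startTime_strictMono ht
  obtain ⟨k, hk⟩ := exists_nat_ge |τ|
  have hne : ∃ i, startTime t i ≤ τ := ⟨-k, (hle k).trans (by linarith [neg_abs_le τ])⟩
  have hbd : ∃ b, ∀ i, startTime t i ≤ τ → i ≤ b := ⟨k, fun i hi =>
    hm.le_iff_le.1 (hi.trans ((le_abs_self τ).trans (hk.trans (hge k))))⟩
  obtain ⟨i, hi, hmax⟩ := Int.exists_greatest_of_bdd hbd hne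
  refine ⟨i, hi, ?_⟩
  by_contra! h
  have := hmax _ h
  omega

/-! ### The contradiction from shadowing -/

section Main

variable {n : ℕ} {M : Type*} [EMetricSpace M] [CompactSpace M]
  [ChartedSpace (EuclideanSpace ℝ (Fin n)) M] [IsManifold (𝓡 n) ∞ M]
  {X : (x : M) → TangentSpace (𝓡 n) x}

/-- The flow of a `C^1` vector field on a closed manifold, as a topological flow. -/
noncomputable def toFlow (hX : IsC1VectorField X) : Flow ℝ M where
  toFun := flow X
  cont' := continuous_flow hX
  map_add' := flow_add hX
  map_zero' := flow_zero hX

theorem IsChainRecurrentSet.transGen {Λ : Set M} (hX : IsC1VectorField X)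
    (hΛ : IsChainRecurrentSet X Λ) {p : M} (hp : p ∈ Λ) {ε : ℝ≥0∞} (hε : 0 < ε) :
    TransGen (ChainStep (toFlow hX) Λ ε) p p := by
  obtain ⟨e, -, he, heε⟩ := ENNReal.lt_iff_exists_real_btwn.1 hε
  have he0 : 0 < e := ENNReal.ofReal_pos.1 he
  obtain ⟨N, x, t, ⟨hlt, ht, hstep⟩, hmem, h0, hN⟩ := hΛ.chain p hp e he0
  simp only [toExtInt, WithBot.coe_le_coe, WithTop.coe_le_coe, WithBot.coe_lt_coe,
    WithTop.coe_lt_coe] at hlt ht hstep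
  have key : ∀ k : ℕ, k < N → TransGen (ChainStep (toFlow hX) Λ ε) (x 0) (x (k + 1)) := by
    intro k
    induction k with
    | zero =>
      intro hk
      refine .single ⟨hmem _ le_rfl (by omega), hmem _ (by simp) (by simpa using Nat.succ_le_of_lt hk), t 0,
        ht 0 le_rfl (by omega), ?_⟩
      change edist (flow X _ _) _ ≤ ε
      simpa using (hstep 0 le_rfl (by omega)).trans heε.le
    | succ k ih =>
      intro hk
      refine (ih (by omega)).tail ⟨hmem _ (by omega) (by omega), hmem _ (by omega) (by omega),
        t (k + 1), ht _ (by omega) (by omega), ?_⟩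
      change edist (flow X _ _) _ ≤ ε
      have := (hstep (k + 1) (by omega) (by omega)).trans heε.le
      simpa using this
  obtain ⟨k, rfl⟩ : ∃ k, N = k + 1 := ⟨N - 1, by omega⟩
  have := key k (Nat.lt_succ_self k)
  rw [h0] at this
  push_cast at hN
  rwa [hN] at this

/-- A noninjective integral curve is periodic, and a periodic curve tending to `σ` is constantly
`σ`, which is not regular. Injectivity turns distinct crossing times into distinct boundary points.
-/
theorem flow_injective_of_mem_HL (hX : IsC1VectorField X) {σ p : M} (hσ : IsSingularity X σ)
    (hp : p ∈ HL X σ) :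
    Function.Injective fun t => flow X t p := by
  obtain ⟨hreg, hs, -⟩ := hp
  have hγ := isMIntegralCurve_flow hX p
  have hxor := hγ.periodic_xor_injective hX
  refine hxor.or.resolve_left ?_
  rintro ⟨T, hT, hper⟩
  have hconst : ∀ t, flow X t p = σ := by
    intro t
    have h1 : Tendsto (fun k : ℕ => flow X (t + k * T) p) atTop (𝓝 σ) :=
      hs.comp (tendsto_atTop_add_const_left _ t
        (tendsto_natCast_atTop_atTop.atTop_mul_const hT))
    have h2 : ∀ k : ℕ, flow X (t + k * T) p = flow X t p := fun k => by
      simpa using hper.nat_mul k t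
    simp only [h2] at h1
    exact tendsto_nhds_unique tendsto_const_nhds h1
  have h0 := hconst 0
  rw [flow_zero hX] at h0
  exact hreg (h0 ▸ hσ)

theorem not_hasShadowingProperty_of_isolatingBox (hX : IsC1VectorField X) {Λ : Set M}
    (hΛ : IsChainRecurrentSet X Λ) {σ : M} (hσΛ : σ ∈ Λ) (hatt : IsAttached X Λ σ)
    (hloops : ∀ V : Set M, IsAdaptedNhd X σ V →
      ∃ N : ℕ, 0 < N ∧ ∀ p ∈ HL X σ, crossings X V p ≤ N)
    (B : IsolatingBox (toFlow hX) σ) : ¬ HasShadowingProperty X Λ := by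
  intro hsh
  have hσ : ∀ t, toFlow hX t σ = σ := flow_eq_self_of_isSingularity hX hatt.1
  have hσ' : ∀ t, flow X t σ = σ := hσ
  have hc : 0 < B.r / 2 := half_pos B.r_pos
  have hcr : B.r / 2 < B.r := half_lt_self B.r_pos
  set c := B.r / 2
  have hclosed : IsClosed (B.box c) := (B.isCompact_box hcr.le).isClosed
  obtain ⟨N, -, hN⟩ := hloops (B.box c) ⟨B.box_mem_nhds hc, fun p hp =>
    B.finite_frontier_inter_orbit hσ hc hcr.le hp.2.1 hp.2.2⟩
  -- `ε₁` is the gap between the box of size `c` and the outside of the open box of size `B.r`; `ε₂`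
  -- below is the distance of `σ` to the outside of the open box of size `c`. Shadowing below both
  -- puts `y` inside near `σ` and outside near `w`.
  obtain ⟨ε₁, hε₁, h₁⟩ := Metric.exists_pos_forall_lt_edist (B.isCompact_box hcr.le)
    (B.isOpen_openBox B.r).isClosed_compl
    (disjoint_compl_right_iff_subset.2 (B.box_subset_openBox hcr))
  obtain ⟨ε₂, hε₂, h₂⟩ := Metric.exists_pos_forall_lt_edist (isCompact_singleton (x := σ))
    (B.isOpen_openBox c).isClosed_compl
    (disjoint_compl_right_iff_subset.2 (singleton_subset_iff.2 (B.rest_mem_openBox hc)))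
  obtain ⟨δ, hδ, hsh⟩ := hsh (min ε₁ ε₂ : ℝ≥0) (by positivity)
  have hnear : ∀ z, edist z σ ≤ ENNReal.ofReal (min ε₁ ε₂ : ℝ≥0) → z ∈ B.openBox c := by
    intro z hz
    by_contra hz'
    have h := h₂ σ rfl z hz'
    rw [edist_comm, ENNReal.ofReal_coe_nnreal] at hz
    exact absurd (hz.trans (ENNReal.coe_le_coe.2 (min_le_right _ _))) (not_le.2 h)
  have hfar : ∀ z w, w ∉ B.box B.r → edist z w ≤ ENNReal.ofReal (min ε₁ ε₂ : ℝ≥0) →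
      z ∉ B.box c := by
    intro z w hw hz hz'
    have h := h₁ z hz' w fun h => hw (B.openBox_subset_box _ h)
    rw [ENNReal.ofReal_coe_nnreal] at hz
    exact absurd (hz.trans (ENNReal.coe_le_coe.2 (min_le_left _ _))) (not_le.2 h)
  have hinv : ∀ t, ∀ x ∈ Λ, toFlow hX t x ∈ Λ := fun t x hx =>
    (hΛ.invariant t).subset (mem_image_of_mem _ hx)
  obtain ⟨q, hq, hchain⟩ := exists_transGen_through hinv
    (fun p hp ε hε => hΛ.transGen hX hp hε) hσΛ hσ (fun z hz => hz.1) hatt.2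
    (ENNReal.ofReal_pos.2 hδ)
  obtain ⟨t₀, ht₀⟩ : ∃ t, toFlow hX t q ∉ B.box B.r := by
    by_contra! h
    exact hq.2 (B.eq_rest hσ h ▸ hatt.1)
  set w := toFlow hX t₀ q
  have hσσ : ChainStep (toFlow hX) Λ (ENNReal.ofReal δ) σ σ :=
    ⟨hσΛ, hσΛ, 1, le_rfl, by simp [hσ]⟩
  -- One turn more than the bound `N` permits; `k` is the position of the excursion to `w` in each
  -- turn.
  obtain ⟨x, k, m, hk, hkm, hstep, hx0, hxN, hxσ, hxw⟩ :=
    exists_repeated_loop hσσ (hchain t₀).1 (hchain t₀).2 (N + 1)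
  choose hxΛ _ t ht hjump using hstep
  obtain ⟨y, hyΛ, h, h0, hy⟩ := hsh ⊥ ⊤ x t bot_le le_top
    ⟨bot_lt_top, fun i _ _ => ht i, fun i _ _ => hjump i⟩ fun i _ _ => hxΛ i
  replace hy := fun i => hy i bot_le le_top
  have hmono := startTime_strictMono ht
  have hat : ∀ i, edist (flow X (h (startTime t i)) y) (x i) ≤
      ENNReal.ofReal (min ε₁ ε₂ : ℝ≥0) := by
    intro i
    have := hy i (startTime t i) ⟨le_rfl, hmono (lt_add_one i)⟩
    rwa [sub_self, flow_zero hX] at this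
  have hrest : ∀ i, x i = σ → ∀ τ ∈ Ico (startTime t i) (startTime t (i + 1)),
      flow X (h τ) y ∈ B.openBox c := by
    intro i hi τ hτ
    have := hy i τ hτ
    rw [hi, hσ'] at this
    exact hnear _ this
  -- After the last turn the pseudo-orbit rests at `σ`, and surjectivity of `h` means that every
  -- later time of the orbit of `y` is compared with it.
  have hs : y ∈ stableSet X σ := by
    refine B.tendsto_atTop hσ (T := h (startTime t ((N + 1 : ℕ) * m))) fun τ hτ => ?_
    obtain ⟨τ, rfl⟩ := h.surjective τ
    obtain ⟨i, hi⟩ := exists_mem_Ico_startTime ht τ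
    refine B.box_mono hcr.le (B.openBox_subset_box _ (hrest i (hxN i ?_) τ hi))
    have := hmono.lt_iff_lt.1 ((h.le_iff_le.1 hτ).trans_lt hi.2)
    omega
  have hu : y ∈ unstableSet X σ := by
    refine B.tendsto_atBot hσ (T := h (startTime t 0)) fun τ hτ => ?_
    obtain ⟨τ, rfl⟩ := h.surjective τ
    obtain ⟨i, hi⟩ := exists_mem_Ico_startTime ht τ
    refine B.box_mono hcr.le (B.openBox_subset_box _ (hrest i (hx0 i ?_) τ hi))
    exact hmono.le_iff_le.1 (hi.1.trans (h.le_iff_le.1 hτ))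
  have hfary : ∀ j : ℕ, j < N + 1 → flow X (h (startTime t (j * m + k))) y ∉ B.box c := by
    intro j hj
    have := hat (j * m + k)
    rw [hxw j hj] at this
    exact hfar _ _ ht₀ this
  have hreg : ¬ IsSingularity X y := by
    intro hsing
    have hfix := flow_eq_self_of_isSingularity hX hsing
    have h1 : y = σ := by
      have : Tendsto (fun t => flow X t y) atTop (𝓝 σ) := hs
      simp only [hfix] at this
      exact tendsto_nhds_unique tendsto_const_nhds this
    have h2 := hfary 0 (Nat.succ_pos N)
    rw [hfix, h1] at h2
    exact h2 (mem_of_mem_nhds (B.box_mem_nhds hc))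
  have hHL : y ∈ HL X σ := ⟨hreg, hs, hu⟩
  -- Each turn contributes a passage from the open box, at its start, to a point outside, at its
  -- visit to `w`.
  have hcross : ((N + 1 : ℕ) : ℕ∞) ≤ crossings X (B.box c) y := by
    refine le_encard_frontier_inter_range (isMIntegralCurve_flow hX y).continuous
      (flow_injective_of_mem_HL hX hatt.1 hHL) (a := fun j => h (startTime t (j * m)))
      (b := fun j => h (startTime t (j * m + k))) ?_ ?_ ?_ ?_
    · intro j _
      exact h.monotone (hmono.monotone (by omega))
    · intro i j hij _
      refine h.monotone (hmono.monotone ?_)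
      have : ((i : ℤ) + 1) * m ≤ j * m := mul_le_mul_of_nonneg_right (by omega) (by omega)
      linarith
    · intro j hj
      have := hat (j * m)
      rw [hxσ j hj.le] at this
      exact B.openBox_subset_interior c (hnear _ this)
    · intro j hj
      rw [hclosed.closure_eq]
      exact hfary j hj
  have := hcross.trans (hN y hHL)
  rw [Nat.cast_le] at this
  omega

end Main

/-! ### Quadratic Lyapunov forms -/

section LinearLyapunov

variable {E : Type*} [NormedAddCommGroup E] [InnerProductSpace ℝ E]

/-- A Lyapunov quadratic form for the part of the linear flow `exp (t A)` in the range of `R`, if the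
flow contracts that range after some time. -/
theorem exists_lyapunov_form [CompleteSpace E] (A R : E →L[ℝ] E) (hAR : A * R = R * A) {T : ℝ} (hT : 0 < T)
    (hcontr : ∀ v, ‖NormedSpace.exp (T • A) (R v)‖ ^ 2 ≤ 1 / 2 * ‖R v‖ ^ 2) :
    ∃ G : E →L[ℝ] E, (∀ v w, ⟪G v, w⟫_ℝ = ⟪v, G w⟫_ℝ) ∧
      (∃ c > 0, ∀ v, c * ‖R v‖ ^ 2 ≤ ⟪G v, v⟫_ℝ) ∧ (∃ C > 0, ∀ v, ⟪G v, v⟫_ℝ ≤ C * ‖R v‖ ^ 2) ∧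
      ∀ v, ⟪G v, A v⟫_ℝ ≤ -(1 / 4) * ‖R v‖ ^ 2 := by
  set F : ℝ → E →L[ℝ] E := fun t => NormedSpace.exp (t • A) * R with hF
  have hderiv : ∀ t, HasDerivAt F (F t * A) t := by
    intro t
    have h := (hasDerivAt_exp_smul_const A t).mul_const R
    rwa [mul_assoc, hAR, ← mul_assoc] at h
  have hFc : Continuous F := continuous_iff_continuousAt.2 fun t => (hderiv t).continuousAt
  have hGc : Continuous fun t => (ContinuousLinearMap.adjoint (F t)) * F t :=
    (ContinuousLinearMap.adjoint.continuous.comp hFc).mul hFc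
  -- The form averages the squared norm along the linear flow over `[0, T]`. A finite time suffices:
  -- its derivative along `A` is the difference of the end values, which the contraction at time `T`
  -- makes negative.
  set G : E →L[ℝ] E := ∫ t in (0 : ℝ)..T, (ContinuousLinearMap.adjoint (F t)) * F t with hG
  have hinner : ∀ v w, ⟪G v, w⟫_ℝ = ∫ t in (0 : ℝ)..T, ⟪F t v, F t w⟫_ℝ := by
    intro v w
    have h := ContinuousLinearMap.intervalIntegral_comp_comm
      ((innerSL ℝ w).comp (ContinuousLinearMap.apply ℝ E v))
      (hGc.intervalIntegrable (μ := MeasureTheory.volume) 0 T)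
    have h2 : ((innerSL ℝ w).comp (ContinuousLinearMap.apply ℝ E v)) G = ⟪G v, w⟫_ℝ := by
      simp [real_inner_comm]
    rw [← h2, hG, ← h]
    refine intervalIntegral.integral_congr fun t _ => ?_
    change ⟪w, ContinuousLinearMap.adjoint (F t) (F t v)⟫_ℝ = ⟪F t v, F t w⟫_ℝ
    rw [ContinuousLinearMap.adjoint_inner_right, real_inner_comm]
  have hFcv : ∀ v, Continuous fun t => F t v := fun v => hFc.clm_apply continuous_const
  have hnc : ∀ v, Continuous fun t => ‖F t v‖ ^ 2 := fun v => (hFcv v).norm.pow 2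
  have hnorm : ∀ v, ⟪G v, v⟫_ℝ = ∫ t in (0 : ℝ)..T, ‖F t v‖ ^ 2 := by
    intro v
    simp only [hinner, real_inner_self_eq_norm_sq]
  refine ⟨G, fun v w => ?_, ?_, ?_, fun v => ?_⟩
  · rw [real_inner_comm (G w) v, hinner, hinner]
    exact intervalIntegral.integral_congr fun t _ => real_inner_comm _ _
  · have hbc : Continuous fun t : ℝ => ‖NormedSpace.exp ((-t) • A)‖ ^ 2 := by
      have : Continuous fun t : ℝ => NormedSpace.exp (t • A) :=
        continuous_iff_continuousAt.2 fun t => (hasDerivAt_exp_smul_const A t).continuousAt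
      exact (this.comp continuous_neg).norm.pow 2
    obtain ⟨K, hK⟩ := (isCompact_Icc (a := (0 : ℝ)) (b := T)).bddAbove_image hbc.continuousOn
    have hK1 : 0 < max K 1 := lt_max_of_lt_right one_pos
    refine ⟨T * (max K 1)⁻¹, by positivity, fun v => ?_⟩
    have hle : ∀ t ∈ Icc 0 T, (max K 1)⁻¹ * ‖R v‖ ^ 2 ≤ ‖F t v‖ ^ 2 := by
      intro t ht
      -- Undoing the flow for time `t` bounds `R v` by `F t v`, uniformly on the compact interval.
      have h1 : R v = NormedSpace.exp ((-t) • A) (F t v) := by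
        have h2 : NormedSpace.exp ((-t) • A) * NormedSpace.exp (t • A) = 1 := by
          let : NormedAlgebra ℚ (E →L[ℝ] E) := NormedAlgebra.restrictScalars ℚ ℝ _
          rw [← NormedSpace.exp_add_of_commute, ← add_smul]
          · simp
          · exact ((Commute.refl A).smul_left _).smul_right _
        change R v = (NormedSpace.exp ((-t) • A) * NormedSpace.exp (t • A)) (R v)
        rw [h2]
        rfl
      rw [inv_mul_le_iff₀ hK1]
      calc ‖R v‖ ^ 2 ≤ (‖NormedSpace.exp ((-t) • A)‖ * ‖F t v‖) ^ 2 := by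
            conv_lhs => rw [h1]
            gcongr
            exact ContinuousLinearMap.le_opNorm _ _
        _ = ‖NormedSpace.exp ((-t) • A)‖ ^ 2 * ‖F t v‖ ^ 2 := mul_pow _ _ _
        _ ≤ max K 1 * ‖F t v‖ ^ 2 := by
            gcongr
            exact (hK (mem_image_of_mem _ ht)).trans (le_max_left _ _)
    rw [hnorm]
    have := intervalIntegral.integral_mono_on hT.le (intervalIntegrable_const (c := (max K 1)⁻¹ * ‖R v‖ ^ 2))
      ((hnc v).intervalIntegrable (μ := MeasureTheory.volume) 0 T) hle
    rw [intervalIntegral.integral_const] at this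
    simpa [mul_assoc] using this
  · have hbc : Continuous fun t : ℝ => ‖NormedSpace.exp (t • A)‖ ^ 2 := by
      have : Continuous fun t : ℝ => NormedSpace.exp (t • A) :=
        continuous_iff_continuousAt.2 fun t => (hasDerivAt_exp_smul_const A t).continuousAt
      exact this.norm.pow 2
    obtain ⟨K, hK⟩ := (isCompact_Icc (a := (0 : ℝ)) (b := T)).bddAbove_image hbc.continuousOn
    have hK1 : 0 < max K 1 := lt_max_of_lt_right one_pos
    refine ⟨T * max K 1, by positivity, fun v => ?_⟩
    have hle : ∀ t ∈ Icc 0 T, ‖F t v‖ ^ 2 ≤ max K 1 * ‖R v‖ ^ 2 := by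
      intro t ht
      calc ‖F t v‖ ^ 2 ≤ (‖NormedSpace.exp (t • A)‖ * ‖R v‖) ^ 2 := by
            gcongr
            exact ContinuousLinearMap.le_opNorm (NormedSpace.exp (t • A)) (R v)
        _ = ‖NormedSpace.exp (t • A)‖ ^ 2 * ‖R v‖ ^ 2 := mul_pow _ _ _
        _ ≤ max K 1 * ‖R v‖ ^ 2 := by
            gcongr
            exact (hK (mem_image_of_mem _ ht)).trans (le_max_left _ _)
    rw [hnorm]
    have := intervalIntegral.integral_mono_on hT.le
      ((hnc v).intervalIntegrable (μ := MeasureTheory.volume) 0 T)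
      (intervalIntegrable_const (c := max K 1 * ‖R v‖ ^ 2)) hle
    rw [intervalIntegral.integral_const] at this
    simpa [mul_assoc] using this
  · have hd : ∀ t, HasDerivAt (fun t => ‖F t v‖ ^ 2) (2 * ⟪F t v, F t (A v)⟫_ℝ) t := by
      intro t
      have h1 : HasDerivAt (fun t => F t v) (F t (A v)) t := by
        simpa using (hderiv t).clm_apply (hasDerivAt_const t v)
      exact h1.norm_sq
    have hint := intervalIntegral.integral_eq_sub_of_hasDerivAt (a := 0) (b := T) (fun t _ => hd t)
      ((continuous_const.mul ((hFcv v).inner (hFcv (A v)))).intervalIntegrable _ _)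
    rw [intervalIntegral.integral_const_mul, ← hinner] at hint
    have hF0 : F 0 v = R v := by simp [hF]
    have hFT : ‖F T v‖ ^ 2 ≤ 1 / 2 * ‖R v‖ ^ 2 := hcontr v
    rw [hF0] at hint
    linarith

theorem hasDerivAt_inner_self {G : E →L[ℝ] E} (hG : ∀ v w, ⟪G v, w⟫_ℝ = ⟪v, G w⟫_ℝ) {u : ℝ → E}
    {u' : E} {t : ℝ} (hu : HasDerivAt u u' t) :
    HasDerivAt (fun t => ⟪G (u t), u t⟫_ℝ) (2 * ⟪G (u t), u'⟫_ℝ) t := by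
  have h := (G.hasFDerivAt.comp_hasDerivAt t hu).inner ℝ hu
  refine h.congr_deriv ?_
  simp only [Function.comp_apply]
  rw [hG u', real_inner_comm]
  ring

/-- Near a zero of a vector field whose linear part admits Lyapunov forms in two complementary
directions these are Lyapunov functions for the vector field. -/
theorem exists_radius_lyapunov {f : E → E} {u₀ : E} {A P Q Gs Gu : E →L[ℝ] E}
    (hf : HasFDerivAt f A u₀) (hf0 : f u₀ = 0) (hPQ : ∀ v, P v + Q v = v) {c C : ℝ} (hc : 0 < c)
    (hC : 0 < C) (hsl : ∀ v, c * ‖P v‖ ^ 2 ≤ ⟪Gs v, v⟫_ℝ) (hsu : ∀ v, ⟪Gs v, v⟫_ℝ ≤ C * ‖P v‖ ^ 2)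
    (hul : ∀ v, c * ‖Q v‖ ^ 2 ≤ ⟪Gu v, v⟫_ℝ) (huu : ∀ v, ⟪Gu v, v⟫_ℝ ≤ C * ‖Q v‖ ^ 2)
    (hs : ∀ v, ⟪Gs v, A v⟫_ℝ ≤ -(1 / 4) * ‖P v‖ ^ 2)
    (hu : ∀ v, 1 / 4 * ‖Q v‖ ^ 2 ≤ ⟪Gu v, A v⟫_ℝ) :
    ∃ ρ > 0, ∀ u, ‖u - u₀‖ ≤ ρ → u ≠ u₀ →
      (⟪Gu (u - u₀), u - u₀⟫_ℝ ≤ ⟪Gs (u - u₀), u - u₀⟫_ℝ → 2 * ⟪Gs (u - u₀), f u⟫_ℝ < 0) ∧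
      (⟪Gs (u - u₀), u - u₀⟫_ℝ ≤ ⟪Gu (u - u₀), u - u₀⟫_ℝ → 0 < 2 * ⟪Gu (u - u₀), f u⟫_ℝ) ∧
      2 * ⟪Gs (u - u₀), f u⟫_ℝ < 2 * ⟪Gu (u - u₀), f u⟫_ℝ := by
  set g := ‖Gs‖ + ‖Gu‖ + 1 with hg
  have hg0 : 0 < g := by positivity
  -- If one form dominates, its component controls the other by the ratio `C / c`, so `‖v‖ ^ 2` is
  -- at most `k` times the square of that component. `κ` makes the remainder at most a quarter of
  -- the linear decay or growth rate `1 / 4`.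
  set k := 2 + 2 * (C / c) with hk
  have hk0 : 0 < k := by positivity
  have hk2 : 2 ≤ k := by
    have : 0 < C / c := by positivity
    linarith
  set κ := 1 / (16 * g * k) with hκ
  have hκ0 : 0 < κ := by positivity
  have hgκ : g * κ * k = 1 / 16 := by
    rw [hκ]; field_simp
  have hlit := hf.isLittleO.def hκ0
  obtain ⟨ρ, hρ, hball⟩ := Metric.nhds_basis_closedBall.eventually_iff.1 hlit
  refine ⟨ρ, hρ, fun u huρ hne => ?_⟩
  set v := u - u₀ with hv
  have hv0 : 0 < ‖v‖ ^ 2 := by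
    have := norm_pos_iff.2 (sub_ne_zero.2 hne)
    positivity
  have hrem : ‖f u - A v‖ ≤ κ * ‖v‖ := by
    have := hball (x := u) (by rwa [Metric.mem_closedBall, dist_eq_norm])
    rwa [hf0, sub_zero] at this
  have hrem' : ∀ G : E →L[ℝ] E, ‖G‖ ≤ g → |⟪G v, f u - A v⟫_ℝ| ≤ g * κ * ‖v‖ ^ 2 := by
    intro G hGg
    calc |⟪G v, f u - A v⟫_ℝ| ≤ ‖G v‖ * ‖f u - A v‖ := abs_real_inner_le_norm _ _
      _ ≤ (g * ‖v‖) * (κ * ‖v‖) := by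
          gcongr
          exact (G.le_opNorm v).trans (by gcongr)
      _ = g * κ * ‖v‖ ^ 2 := by ring
  have hS := abs_le.1 (hrem' Gs (by rw [hg]; linarith [norm_nonneg Gu]))
  have hU := abs_le.1 (hrem' Gu (by rw [hg]; linarith [norm_nonneg Gs]))
  rw [inner_sub_right] at hS hU
  have hnv : ‖v‖ ^ 2 ≤ 2 * ‖P v‖ ^ 2 + 2 * ‖Q v‖ ^ 2 := by
    have h1 : ‖v‖ ≤ ‖P v‖ + ‖Q v‖ := by
      conv_lhs => rw [← hPQ v]
      exact norm_add_le _ _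
    nlinarith [sq_nonneg (‖P v‖ - ‖Q v‖), norm_nonneg v, norm_nonneg (P v), norm_nonneg (Q v)]
  have hcompare : ∀ a b : ℝ, c * a ≤ C * b → 2 * b + 2 * a ≤ k * b := by
    intro a b hab
    have : a ≤ C / c * b := by
      rw [div_mul_eq_mul_div, le_div_iff₀ hc]
      linarith
    rw [hk]
    linarith
  have hgκ0 : 0 < g * κ := by positivity
  refine ⟨fun hle => ?_, fun hle => ?_, ?_⟩
  · have h1 := hcompare _ _ (((hul v).trans hle).trans (hsu v))
    have h2 : g * κ * ‖v‖ ^ 2 ≤ 1 / 16 * ‖P v‖ ^ 2 := by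
      rw [← hgκ, mul_assoc (g * κ)]
      exact mul_le_mul_of_nonneg_left (hnv.trans h1) hgκ0.le
    have h3 : 0 < ‖P v‖ ^ 2 := by
      have := hv0.trans_le (hnv.trans h1)
      exact (pos_iff_pos_of_mul_pos this).1 hk0
    linarith [hs v]
  · have h1 := hcompare _ _ (((hsl v).trans hle).trans (huu v))
    have h2 : g * κ * ‖v‖ ^ 2 ≤ 1 / 16 * ‖Q v‖ ^ 2 := by
      rw [← hgκ, mul_assoc (g * κ)]
      exact mul_le_mul_of_nonneg_left (hnv.trans (by linarith)) hgκ0.le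
    have h3 : 0 < ‖Q v‖ ^ 2 := by
      have : 0 < k * ‖Q v‖ ^ 2 := hv0.trans_le (hnv.trans (by linarith))
      exact (pos_iff_pos_of_mul_pos this).1 hk0
    linarith [hu v]
  -- Here no component dominates, but both linear terms help, and two remainders are still beaten by
  -- their sum.
  · have h2 : g * κ * 2 ≤ 1 / 16 := by
      rw [← hgκ]
      exact mul_le_mul_of_nonneg_left hk2 hgκ0.le
    have h3 : g * κ * ‖v‖ ^ 2 ≤ 1 / 32 * ‖v‖ ^ 2 := by gcongr; linarith
    linarith [hu v, hs v]

end LinearLyapunov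

/-! ### The hyperbolic splitting in the model space -/

/-- The Riemannian norm of a tangent space is bounded by a multiple of the norm of the model space. -/
theorem exists_tangent_norm_le {n : ℕ} {M : Type*} [TopologicalSpace M]
    [ChartedSpace (EuclideanSpace ℝ (Fin n)) M] [IsManifold (𝓡 n) ∞ M]
    [RiemannianBundle (fun x : M => TangentSpace (𝓡 n) x)] (σ : M) :
    ∃ K > (0 : ℝ), ∀ (v : TangentSpace (𝓡 n) σ) (w : EuclideanSpace ℝ (Fin n)), w = v →
      ‖v‖ ≤ K * ‖w‖ := by
  -- The identity between two norms on one space, bounded because the dimension is finite.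
  let f : EuclideanSpace ℝ (Fin n) →ₗ[ℝ] TangentSpace (𝓡 n) σ :=
    { toFun := fun v => v, map_add' := fun _ _ => rfl, map_smul' := fun _ _ => rfl }
  obtain ⟨b, hb, hfb⟩ : ∃ b : ℝ, 0 ≤ b ∧ ∀ w, ‖f w‖ ≤ b * ‖w‖ :=
    ⟨_, (LinearMap.toContinuousLinearMap f).opNorm_nonneg,
      (LinearMap.toContinuousLinearMap f).le_opNorm⟩
  refine ⟨b + 1, by positivity, fun v w hwv => ?_⟩
  have h := hfb w
  have h' : f w = v := hwv
  rw [h'] at h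
  exact h.trans (mul_le_mul_of_nonneg_right (by linarith) (norm_nonneg w))

/-- The Riemannian norm of `v` on the right of the estimates is at most `K` times its model norm;
the factor is absorbed into the constant. -/
theorem exists_hyperbolic_splitting {n : ℕ} {M : Type*} [TopologicalSpace M]
    [ChartedSpace (EuclideanSpace ℝ (Fin n)) M] [IsManifold (𝓡 n) ∞ M]
    [RiemannianBundle (fun x : M => TangentSpace (𝓡 n) x)]
    {X : (x : M) → TangentSpace (𝓡 n) x} {σ : M} (hσ : IsHyperbolicSingularity X σ) :
    ∃ Es Eu : Submodule ℝ (EuclideanSpace ℝ (Fin n)), IsCompl Es Eu ∧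
      (∀ v ∈ Es, linearPart X σ v ∈ Es) ∧ (∀ v ∈ Eu, linearPart X σ v ∈ Eu) ∧
      ∃ C > (0 : ℝ), ∃ lam > (0 : ℝ), ∀ t : ℝ, 0 ≤ t →
        (∀ v ∈ Es, ‖NormedSpace.exp (t • linearPart X σ) v‖ ≤ C * Real.exp (-lam * t) * ‖v‖) ∧
        (∀ v ∈ Eu, ‖NormedSpace.exp (t • -linearPart X σ) v‖ ≤
          C * Real.exp (-lam * t) * ‖v‖) := by
  obtain ⟨-, Es, Eu, hc, hs, hu, C, hC, lam, hlam, hb⟩ := hσ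
  obtain ⟨K, hK, hKv⟩ := exists_tangent_norm_le (n := n) (M := M) σ
  refine ⟨Es, Eu, hc, hs, hu, C * K, by positivity, lam, hlam, fun t ht => ⟨fun v hv => ?_,
    fun v hv => ?_⟩⟩
  · calc ‖NormedSpace.exp (t • linearPart X σ) v‖
        ≤ C * Real.exp (-lam * t) * @norm (TangentSpace (𝓡 n) σ) _ v := (hb t ht).1 v hv
      _ ≤ C * Real.exp (-lam * t) * (K * ‖v‖) := by
          gcongr
          exact hKv v v rfl
      _ = C * K * Real.exp (-lam * t) * ‖v‖ := by ring
  · rw [smul_neg, ← neg_smul]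
    calc ‖NormedSpace.exp ((-t) • linearPart X σ) v‖
        ≤ C * Real.exp (-lam * t) * @norm (TangentSpace (𝓡 n) σ) _ v := (hb t ht).2 v hv
      _ ≤ C * Real.exp (-lam * t) * (K * ‖v‖) := by
          gcongr
          exact hKv v v rfl
      _ = C * K * Real.exp (-lam * t) * ‖v‖ := by ring

section Linear

variable {E : Type*} [NormedAddCommGroup E] [InnerProductSpace ℝ E]

theorem exists_commuting_projections [FiniteDimensional ℝ E] (A : E →L[ℝ] E)
    {Es Eu : Submodule ℝ E} (hc : IsCompl Es Eu) (hs : ∀ v ∈ Es, A v ∈ Es)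
    (hu : ∀ v ∈ Eu, A v ∈ Eu) :
    ∃ P Q : E →L[ℝ] E, (∀ v, P v ∈ Es) ∧ (∀ v, Q v ∈ Eu) ∧ (∀ v, P v + Q v = v) ∧
      A * P = P * A ∧ A * Q = Q * A := by
  set P := LinearMap.toContinuousLinearMap (Es.projection Eu hc)
  set Q := LinearMap.toContinuousLinearMap (Eu.projection Es hc.symm)
  have hP : ∀ v, P v ∈ Es := fun v => Submodule.projection_apply_mem hc v
  have hQ : ∀ v, Q v ∈ Eu := fun v => Submodule.projection_apply_mem hc.symm v
  have hPQ : ∀ v, P v + Q v = v := fun v => Submodule.projection_add_projection_eq_self hc v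
  -- The commutator of `P` and `A` takes values in `Es`, and being minus that of `Q` and `A`, also
  -- in `Eu`.
  have key : ∀ v, P (A v) = A (P v) := by
    intro v
    have h1 : P (A v) - A (P v) = A (Q v) - Q (A v) := by
      have h2 := hPQ (A v)
      have h3 : A (P v) + A (Q v) = A v := by rw [← map_add, hPQ]
      rw [sub_eq_sub_iff_add_eq_add, h2, add_comm, h3]
    have h4 : P (A v) - A (P v) ∈ Eu := h1 ▸ Eu.sub_mem (hu _ (hQ v)) (hQ _)
    exact sub_eq_zero.1 (Submodule.disjoint_def.1 hc.disjoint _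
      (Es.sub_mem (hP _) (hs _ (hP v))) h4)
  refine ⟨P, Q, hP, hQ, hPQ, ?_, ?_⟩
  · ext1 v
    exact (key v).symm
  · ext1 v
    have h2 := hPQ (A v)
    have h3 : A (P v) + A (Q v) = A v := by rw [← map_add, hPQ]
    rw [key] at h2
    exact add_left_cancel (h3.trans h2.symm)

theorem exists_time_contraction {C lam : ℝ} (hlam : 0 < lam) :
    ∃ T > 0, (C * Real.exp (-lam * T)) ^ 2 ≤ 1 / 2 := by
  have h : Tendsto (fun T : ℝ => (C * Real.exp (-lam * T)) ^ 2) atTop (𝓝 0) := by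
    have h1 : Tendsto (fun T : ℝ => Real.exp (-lam * T)) atTop (𝓝 0) :=
      Real.tendsto_exp_atBot.comp (tendsto_id.const_mul_atTop_of_neg (neg_lt_zero.2 hlam))
    simpa using (h1.const_mul C).pow 2
  obtain ⟨T, hT, hT0⟩ := ((h.eventually (gt_mem_nhds (by norm_num : (0 : ℝ) < 1 / 2))).and
    (eventually_gt_atTop 0)).exists
  exact ⟨T, hT0, hT.le⟩

end Linear

/-! ### The isolating box of a hyperbolic singularity -/

section Box

variable {n : ℕ} {M : Type*} [EMetricSpace M] [CompactSpace M]
  [ChartedSpace (EuclideanSpace ℝ (Fin n)) M] [IsManifold (𝓡 n) ∞ M]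
  {X : (x : M) → TangentSpace (𝓡 n) x}

/-- A hyperbolic singularity has an isolating box. -/
theorem exists_isolatingBox [RiemannianBundle (fun x : M => TangentSpace (𝓡 n) x)]
    (hX : IsC1VectorField X) {σ : M} (hσ : IsHyperbolicSingularity X σ) :
    Nonempty (IsolatingBox (toFlow hX) σ) := by
  obtain ⟨Es, Eu, hc, hs, hu, K, hK, lam, hlam, hb⟩ := exists_hyperbolic_splitting hσ
  set A := linearPart X σ with hA
  obtain ⟨P, Q, hP, hQ, hPQ, hAP, hAQ⟩ := exists_commuting_projections A hc hs hu
  obtain ⟨T, hT, hKT⟩ := exists_time_contraction (C := K) hlam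
  have hcontr : ∀ a b : ℝ, 0 ≤ a → a ≤ K * Real.exp (-lam * T) * b → a ^ 2 ≤ 1 / 2 * b ^ 2 := by
    intro a b ha hab
    calc a ^ 2 ≤ (K * Real.exp (-lam * T) * b) ^ 2 := by gcongr
      _ = (K * Real.exp (-lam * T)) ^ 2 * b ^ 2 := mul_pow _ _ _
      _ ≤ 1 / 2 * b ^ 2 := by gcongr
  obtain ⟨Gs, hGs, ⟨cs, hcs, hsl⟩, ⟨Cs, hCs, hsu⟩, hsA⟩ := exists_lyapunov_form A P hAP hT
    fun v => hcontr _ _ (norm_nonneg _) ((hb T hT.le).1 _ (hP v))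
  -- The unstable directions are contracted by the reversed linear flow, hence `-A`.
  obtain ⟨Gu, hGu, ⟨cu, hcu, hul⟩, ⟨Cu, hCu, huu⟩, huA⟩ := exists_lyapunov_form (-A) Q
    (by rw [neg_mul, mul_neg, hAQ]) hT
    fun v => hcontr _ _ (norm_nonneg _) ((hb T hT.le).2 _ (hQ v))
  set e := extChartAt (𝓡 n) σ with he
  set u₀ := e σ with hu₀
  set f := chartField X σ with hfdef
  have hf : HasFDerivAt f A u₀ :=
    ((contDiffAt_chartField hX σ).differentiableAt one_ne_zero).hasFDerivAt
  have hX0 : X σ = 0 := hσ.1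
  have hf0 : f u₀ = 0 := by
    have h1 : e.symm u₀ = σ := extChartAt_to_inv σ
    simp only [hfdef, chartField]
    rw [← he, h1, hX0]
    exact map_zero _
  set c := min cs cu
  set C := max Cs Cu
  have hc0 : 0 < c := lt_min hcs hcu
  have hsl' : ∀ v, c * ‖P v‖ ^ 2 ≤ ⟪Gs v, v⟫_ℝ := fun v =>
    (mul_le_mul_of_nonneg_right (min_le_left _ _) (sq_nonneg _)).trans (hsl v)
  have hul' : ∀ v, c * ‖Q v‖ ^ 2 ≤ ⟪Gu v, v⟫_ℝ := fun v =>
    (mul_le_mul_of_nonneg_right (min_le_right _ _) (sq_nonneg _)).trans (hul v)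
  obtain ⟨ρ₀, hρ₀, hlyap⟩ := exists_radius_lyapunov hf hf0 hPQ hc0 (lt_max_of_lt_left hCs : 0 < C)
    hsl' (fun v => (hsu v).trans (mul_le_mul_of_nonneg_right (le_max_left _ _) (sq_nonneg _)))
    hul' (fun v => (huu v).trans (mul_le_mul_of_nonneg_right (le_max_right _ _) (sq_nonneg _)))
    hsA (fun v => by
      have := huA v
      rw [neg_apply, inner_neg_right] at this
      linarith)
  obtain ⟨ρ₁, hρ₁, hball⟩ := Metric.nhds_basis_closedBall.mem_iff.1
    (extChartAt_target_mem_nhds (I := 𝓡 n) σ)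
  set ρ := min ρ₀ ρ₁
  have hρ : 0 < ρ := lt_min hρ₀ hρ₁
  -- With this value each component of a vector in the box has norm at most `ρ / 2`, so the box lies
  -- in the ball where the Lyapunov estimates hold and the chart is defined.
  set r := c * ρ ^ 2 / 4 with hr
  have hr0 : 0 < r := by positivity
  have hsmall : ∀ v, ⟪Gs v, v⟫_ℝ ≤ r → ⟪Gu v, v⟫_ℝ ≤ r → ‖v‖ ≤ ρ := by
    intro v h1 h2
    have hcancel : ∀ a : ℝ, c * a ^ 2 ≤ r → 0 ≤ a → a ≤ ρ / 2 := by
      intro a h ha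
      have h' : a ^ 2 ≤ (ρ / 2) ^ 2 := by
        refine le_of_mul_le_mul_left (h.trans (le_of_eq ?_)) hc0
        rw [hr]; ring
      exact (pow_le_pow_iff_left₀ ha (by positivity) two_ne_zero).1 h'
    calc ‖v‖ = ‖P v + Q v‖ := by rw [hPQ]
      _ ≤ ‖P v‖ + ‖Q v‖ := norm_add_le _ _
      _ ≤ ρ / 2 + ρ / 2 := add_le_add (hcancel _ ((hsl' v).trans h1) (norm_nonneg _))
          (hcancel _ ((hul' v).trans h2) (norm_nonneg _))
      _ = ρ := add_halves ρ
  have hform : ∀ G : EuclideanSpace ℝ (Fin n) →L[ℝ] EuclideanSpace ℝ (Fin n),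
      Continuous fun u => ⟪G (u - u₀), u - u₀⟫_ℝ := fun G => by fun_prop
  have hcont : ∀ G : EuclideanSpace ℝ (Fin n) →L[ℝ] EuclideanSpace ℝ (Fin n),
      ContinuousOn (fun x => ⟪G (e x - u₀), e x - u₀⟫_ℝ) e.source := fun G =>
    (hform G).comp_continuousOn (continuousOn_extChartAt σ)
  refine ⟨{
    O := e.source
    S := fun x => ⟪Gs (e x - u₀), e x - u₀⟫_ℝ
    U := fun x => ⟪Gu (e x - u₀), e x - u₀⟫_ℝ
    r := r
    isOpen := isOpen_extChartAt_source σ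
    mem := mem_extChartAt_source σ
    contS := hcont Gs
    contU := hcont Gu
    S_rest := by simp [hu₀]
    U_rest := by simp [hu₀]
    r_pos := hr0
    compact := ?_
    deriv_zero := ?_ }⟩
  -- The box is the image under the inverse chart of a closed subset of a closed ball.
  · set D := {u | ⟪Gs (u - u₀), u - u₀⟫_ℝ ≤ r ∧ ⟪Gu (u - u₀), u - u₀⟫_ℝ ≤ r} with hD
    have hDρ : D ⊆ Metric.closedBall u₀ ρ := fun u hu => by
      rw [Metric.mem_closedBall, dist_eq_norm]
      exact hsmall _ hu.1 hu.2
    have hDtar : D ⊆ e.target :=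
      hDρ.trans ((Metric.closedBall_subset_closedBall (min_le_right _ _)).trans hball)
    have hDcl : IsClosed D :=
      (isClosed_le (hform Gs) continuous_const).inter (isClosed_le (hform Gu) continuous_const)
    have hDc : IsCompact D := (isCompact_closedBall u₀ ρ).of_isClosed_subset hDcl hDρ
    have himg := hDc.image_of_continuousOn ((continuousOn_extChartAt_symm σ).mono hDtar)
    convert himg using 1
    ext x
    constructor
    · rintro ⟨hx, h⟩
      exact ⟨e x, h, e.left_inv hx⟩
    · rintro ⟨u, hu, rfl⟩
      refine ⟨e.map_target (hDtar hu), ?_⟩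
      rw [← he, e.right_inv (hDtar hu)]
      exact hu
  · intro x hx hSx hUx
    have hd : HasDerivAt (fun t => e (flow X t x) - u₀) (f (e x)) 0 := by
      have h := hasDerivAt_extChartAt_comp (p := σ) (isMIntegralCurve_flow hX x) (t := 0)
        (by rwa [flow_zero hX])
      rw [flow_zero hX] at h
      exact h.sub_const u₀
    have hds := hasDerivAt_inner_self hGs hd
    have hdu := hasDerivAt_inner_self hGu hd
    rw [flow_zero hX] at hds hdu
    refine ⟨_, _, hds, hdu, fun hne => hlyap (e x) ((hsmall _ hSx hUx).trans (min_le_left _ _)) ?_⟩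
    exact fun h => hne (e.injOn hx (mem_extChartAt_source σ) h)

end Box

end ShadowFlow

theorem theoremA {n : ℕ} {M : Type*} [EMetricSpace M] [CompactSpace M]
    [ChartedSpace (EuclideanSpace ℝ (Fin n)) M] [IsManifold (𝓡 n) ∞ M]
    [RiemannianBundle (fun x : M => TangentSpace (𝓡 n) x)]
    [IsContMDiffRiemannianBundle (𝓡 n) ∞ (EuclideanSpace ℝ (Fin n))
      (fun x : M => TangentSpace (𝓡 n) x)]
    [IsRiemannianManifold (𝓡 n) M]
    (X : (x : M) → TangentSpace (𝓡 n) x) (hX : ShadowFlow.IsC1VectorField X)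
    (Λ : Set M) (hΛ : ShadowFlow.IsChainRecurrentSet X Λ)
    (σ : M) (hσΛ : σ ∈ Λ) (hσ : ShadowFlow.IsHyperbolicSingularity X σ)
    (hatt : ShadowFlow.IsAttached X Λ σ)
    (hloops : ∀ V : Set M, ShadowFlow.IsAdaptedNhd X σ V →
      ∃ N : ℕ, 0 < N ∧ ∀ p ∈ ShadowFlow.HL X σ, ShadowFlow.crossings X V p ≤ N) :
    ¬ ShadowFlow.HasShadowingProperty X Λ := by
  obtain ⟨B⟩ := ShadowFlow.exists_isolatingBox hX hσ
  exact ShadowFlow.not_hasShadowingProperty_of_isolatingBox hX hΛ hσΛ hatt hloops B
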